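/- All fields have characteristic zero. A difference field $(\mathbb F,\sigma)$ is a field with a field automorphism $\sigma$; $(\mathbb E,\sigma)$ is a difference field extension of $(\mathbb F,\sigma)$ if $\mathbb F\subseteq\mathbb E$ and the automorphisms agree on $\mathbb F$. Write $\mathrm{const}_\sigma\mathbb F=\{c\in\mathbb F:\sigma(c)=c\}$. A difference field extension $(\mathbb F(t),\sigma)$ of $(\mathbb F,\sigma)$ with $t$ transcendental over $\mathbb F$ and $\mathrm{const}_\sigma\mathbb F(t)=\mathrm{const}_\sigma\mathbb F$ is a (single) $\Sigma^*$-extension if $\sigma(t)=t+a$, and a (single) $\Pi$-extension if $\sigma(t)=a\,t$, for some $a\in\mathbb F\setminus\{0\}$. A $\Sigma^*$-extension (resp. $\Pi\Sigma^*$-extension) $(\mathbb F(t_1)\dots(t_e),\sigma)$ of $(\mathbb F,\sigma)$, $e\ge 0$, is a tower of single $\Sigma^*$-extensions (resp. of single $\Sigma^*$- or $\Pi$-extensions). Depth: let $\mathbb F=\mathbb G(t_1)\dots(t_e)$ be a $\Pi\Sigma^*$-extension of $(\mathbb G,\sigma)$ with $\sigma(t_i)=t_i+a_i$ or $\sigma(t_i)=a_it_i$,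 $a_i\in\mathbb G(t_1)\dots(t_{i-1})$. Define $\delta(t_i)=\delta(a_i)+1$ recursively, where for $g=g_1/g_2$ with coprime $g_1,g_2\in\mathbb G[t_1,\dots,t_e]$, $\delta(g)$ is the maximum of $0$ and of all $\delta(t_j)$ such that $t_j$ occurs in $g_1$ or $g_2$. The extension depth of a $\Pi\Sigma^*$-extension $(\mathbb F(x_1)\dots(x_r),\sigma)$ of $(\mathbb F,\sigma)$ is $\max(0,\delta(x_1),\dots,\delta(x_r))$, where $\delta$ is taken over $\mathbb G$ in the tower $\mathbb G(t_1)\dots(t_e)(x_1)\dots(x_r)$. Depth-optimality: let $(\mathbb F,\sigma)$ be a $\Pi\Sigma^*$-extension of $(\mathbb G,\sigma)$ and $f\in\mathbb F$. A difference field extension $(\mathbb F(s),\sigma)$ of $(\mathbb F,\sigma)$ with $\sigma(s)=s+f$ is called depth-optimal if there is no $\Sigma^*$-extension $(\mathbb E,\sigma)$ of $(\mathbb F,\sigma)$ with extension depth $\le\delta(f)$ containing some $g\in\mathbb E$ with $\sigma(g)-g=f$. A $\Pi\Sigma^*$-extension $(\mathbb G(t_1)\dots(t_e),\sigma)$ of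 $(\mathbb G,\sigma)$ is a $\Pi\Sigma^\delta$-extension if $\mathbb G(t_1)\dots(t_i)$ is a depth-optimal extension of $\mathbb G(t_1)\dots(t_{i-1})$ for every $i$ for which $t_i$ is a $\Sigma^*$-extension. **Theorem.** Let $(\mathbb F,\sigma)$ be a $\Pi\Sigma^\delta$-extension of a difference field $(\mathbb G,\sigma)$, let $f\in\mathbb F$, and let $(\mathbb F(s),\sigma)$ be a $\Sigma^*$-extension of $(\mathbb F,\sigma)$ with $\sigma(s)=s+f$. Then $(\mathbb F(s),\sigma)$ is depth-optimal if and only if there is no $\Pi\Sigma^*$-extension $(\mathbb E,\sigma)$ of $(\mathbb F,\sigma)$ with extension depth $\le\delta(f)$ containing some $g\in\mathbb E$ with $\sigma(g)-g=f$. -/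

import Mathlib

universe u

/-! Difference fields are pairs of a field `F` and a field automorphism `σ : F ≃+* F`; a difference
field extension is a ring homomorphism `ι : G →+* E` (automatically injective) that commutes with
the automorphisms. -/

/-- The subfield `G(t₁,…,tᵢ)` of `E`, generated by the image of `G` and the first `i` of the
elements `t`. -/
def stage {G E : Type u} [Field G] [Field E] (ι : G →+* E) {n : ℕ} (t : Fin n → E) (i : ℕ) :
    Subfield E :=
  Subfield.closure (Set.range ι ∪ t '' {j | (j : ℕ) < i})

/-- For a subfield `K` of `E` and `s : E`: the extension `K(s)` of `K` is a single
`Σ*`-extension. -/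
structure IsSigmaStep {E : Type u} [Field E] (σ : E ≃+* E) (K : Subfield E) (s : E) : Prop where
  transcendental : Transcendental K s
  shift : ∃ a ∈ K, a ≠ 0 ∧ σ s = s + a
  constants : ∀ c ∈ Subfield.closure ((K : Set E) ∪ {s}), σ c = c → c ∈ K

/-- For a subfield `K` of `E` and `s : E`: the extension `K(s)` of `K` is a single
`Π`-extension. -/
structure IsPiStep {E : Type u} [Field E] (σ : E ≃+* E) (K : Subfield E) (s : E) : Prop where
  transcendental : Transcendental K s
  shift : ∃ a ∈ K, a ≠ 0 ∧ σ s = a * s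
  constants : ∀ c ∈ Subfield.closure ((K : Set E) ∪ {s}), σ c = c → c ∈ K

/-- `(E, σ)` with `E = G(t₁)…(tₙ)` is a `ΠΣ*`-extension of `(G, σG)` (along `ι`). -/
structure IsPiSigmaExt {G E : Type u} [Field G] [Field E] (σG : G ≃+* G) (σ : E ≃+* E)
    (ι : G →+* E) {n : ℕ} (t : Fin n → E) : Prop where
  compat : ∀ g, σ (ι g) = ι (σG g)
  generates : stage ι t n = ⊤
  steps : ∀ i : Fin n, IsSigmaStep σ (stage ι t i) (t i) ∨ IsPiStep σ (stage ι t i) (t i)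

/-- `(E, σ)` with `E = G(t₁)…(tₙ)` is a `Σ*`-extension of `(G, σG)` (along `ι`). -/
structure IsSigmaExt {G E : Type u} [Field G] [Field E] (σG : G ≃+* G) (σ : E ≃+* E)
    (ι : G →+* E) {n : ℕ} (t : Fin n → E) : Prop where
  compat : ∀ g, σ (ι g) = ι (σG g)
  generates : stage ι t n = ⊤
  steps : ∀ i : Fin n, IsSigmaStep σ (stage ι t i) (t i)

/-! ### The depth function -/

/-- `tⱼ` occurs in `x = p / q`, where `p, q ∈ G[t₁,…,tₙ]` are coprime. (If the `t` are
algebraically independent, the pair `p, q` is unique up to a nonzero factor from `G`.) -/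
def Occurs {G E : Type u} [Field G] [Field E] (ι : G →+* E) {n : ℕ} (t : Fin n → E)
    (j : Fin n) (x : E) : Prop :=
  ∃ p q : MvPolynomial (Fin n) G, IsRelPrime p q ∧ q.eval₂ ι t ≠ 0 ∧
    x = p.eval₂ ι t / q.eval₂ ι t ∧ (j ∈ p.vars ∨ j ∈ q.vars)

open Classical in
/-- The element `aᵢ` with `σ(tᵢ) = tᵢ + aᵢ` (if `tᵢ` is a `Σ*`-extension) or `σ(tᵢ) = aᵢ tᵢ`
(if `tᵢ` is a `Π`-extension). The two cases exclude each other, and `σ(tᵢ) - tᵢ` lies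
in `G(t₁,…,tᵢ₋₁)` exactly in the first one. -/
noncomputable def stepCoeff {G E : Type u} [Field G] [Field E] (σ : E ≃+* E) (ι : G →+* E)
    {n : ℕ} (t : Fin n → E) (i : Fin n) : E :=
  if σ (t i) - t i ∈ stage ι t i then σ (t i) - t i else σ (t i) / t i

open Classical in
/-- `δ(tᵢ) = δ(aᵢ) + 1`; only `tⱼ` with `j < i` can occur in `aᵢ`. -/
noncomputable def genDepth {G E : Type u} [Field G] [Field E] (σ : E ≃+* E) (ι : G →+* E)
    {n : ℕ} (t : Fin n → E) (i : Fin n) : ℕ :=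
  (Finset.univ.filter
    (fun j : {j : Fin n // j < i} => Occurs ι t j.1 (stepCoeff σ ι t i))).sup
      (fun j => genDepth σ ι t j.1) + 1
termination_by i.val
decreasing_by exact j.2

open Classical in
/-- The depth `δ(x)` over `G` of an element `x` of `E = G(t₁)…(tₙ)`: the maximum of the `δ(tⱼ)`
over all `tⱼ` that occur in `x`, and `0` if there are none. -/
noncomputable def depth {G E : Type u} [Field G] [Field E] (σ : E ≃+* E) (ι : G →+* E)
    {n : ℕ} (t : Fin n → E) (x : E) : ℕ :=
  (Finset.univ.filter (fun j : Fin n => Occurs ι t j x)).sup (genDepth σ ι t)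

/-- For `F = G(t₁)…(tₙ)` over `G` (along `ι`) and `E = F(x₁)…(xᵣ)` over `F` (along `κ`): the
extension depth `max(0, δ(x₁), …, δ(xᵣ))`, where `δ` is the depth over `G` in the tower
`E = G(t₁)…(tₙ)(x₁)…(xᵣ)`. -/
noncomputable def extDepth {G F E : Type u} [Field G] [Field F] [Field E] (ι : G →+* F)
    {n : ℕ} (t : Fin n → F) (σE : E ≃+* E) (κ : F →+* E) {r : ℕ} (x : Fin r → E) : ℕ :=
  Finset.univ.sup fun j : Fin r =>
    genDepth σE (κ.comp ι) (Fin.append (κ ∘ t) x) (Fin.natAdd n j)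

/-! ### Depth-optimal extensions -/

/-- Let `F = G(t₁)…(tₙ)` be a `ΠΣ*`-extension of `G`, let `κ : F →+* S` be a difference field
extension, and let `s : S`, `f : F`. The subextension `F(s)` of `S` with `σ(s) = s + f` is
a depth-optimal `Σ*`-extension of `F`: there is no `Σ*`-extension `E` of `F` with extension depth
at most `δ(f)` that contains some `g` with `σ(g) - g = f`. -/
structure IsSigmaDeltaStep {G F S : Type u} [Field G] [Field F] [Field S] (ι : G →+* F)
    {n : ℕ} (t : Fin n → F) (σF : F ≃+* F) (σS : S ≃+* S) (κ : F →+* S) (s : S) (f : F) :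
    Prop where
  compat : ∀ a, σS (κ a) = κ (σF a)
  shift : σS s = s + κ f
  optimal : ¬ ∃ (E : Type u) (_ : Field E) (σE : E ≃+* E) (κE : F →+* E) (r : ℕ) (x : Fin r → E),
    IsSigmaExt σF σE κE x ∧ extDepth ι t σE κE x ≤ depth σF ι t f ∧
      ∃ g : E, σE g - g = κE f

theorem map_mem_stage {G E : Type u} [Field G] [Field E] (ι : G →+* E) {n : ℕ} (t : Fin n → E)
    (i : ℕ) (g : G) : ι g ∈ stage ι t i :=
  Subfield.subset_closure (Or.inl ⟨g, rfl⟩)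

theorem gen_mem_stage {G E : Type u} [Field G] [Field E] (ι : G →+* E) {n : ℕ} (t : Fin n → E)
    (i : ℕ) (j : Fin n) (hj : (j : ℕ) < i) : t j ∈ stage ι t i :=
  Subfield.subset_closure (Or.inr ⟨j, hj, rfl⟩)

theorem stage_mono {G E : Type u} [Field G] [Field E] (ι : G →+* E) {n : ℕ} (t : Fin n → E)
    {i k : ℕ} (h : i ≤ k) : stage ι t i ≤ stage ι t k := by
  refine Subfield.closure_mono (Set.union_subset_union_right _ (Set.image_mono ?_))
  intro j (hj : (j : ℕ) < i)
  exact lt_of_lt_of_le hj h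

theorem IsPiSigmaExt.stage_stable {G E : Type u} [Field G] [Field E] {σG : G ≃+* G}
    {σ : E ≃+* E} {ι : G →+* E} {n : ℕ} {t : Fin n → E} (h : IsPiSigmaExt σG σ ι t) (i : ℕ) :
    (∀ x ∈ stage ι t i, σ x ∈ stage ι t i) ∧ (∀ x ∈ stage ι t i, σ.symm x ∈ stage ι t i) := by
  induction i using Nat.strong_induction_on with
  | _ i ih =>
    have key : ∀ τ : E →+* E, (∀ y ∈ Set.range ι ∪ t '' {j | (j : ℕ) < i}, τ y ∈ stage ι t i) →
        ∀ x ∈ stage ι t i, τ x ∈ stage ι t i := by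
      intro τ hτ x hx
      have : stage ι t i ≤ (stage ι t i).comap τ := by
        refine (Subfield.closure_le).2 ?_
        intro y hy
        exact hτ y hy
      exact this hx
    constructor
    · refine key σ.toRingHom ?_
      rintro y (⟨g, rfl⟩ | ⟨j, hj, rfl⟩)
      · change σ (ι g) ∈ _
        rw [h.compat]
        exact map_mem_stage ι t i _
      · change σ (t j) ∈ _
        have hj' : (j : ℕ) < i := hj
        have ht := gen_mem_stage ι t i j hj'
        rcases h.steps j with hs | hs <;> obtain ⟨a, ha, -, hs⟩ := hs.shift <;> rw [hs]
        · exact add_mem ht (stage_mono ι t hj'.le ha)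
        · exact mul_mem (stage_mono ι t hj'.le ha) ht
    · refine key σ.symm.toRingHom ?_
      rintro y (⟨g, rfl⟩ | ⟨j, hj, rfl⟩)
      · change σ.symm (ι g) ∈ _
        have : σ.symm (ι g) = ι (σG.symm g) := by
          rw [RingEquiv.symm_apply_eq, h.compat, RingEquiv.apply_symm_apply]
        rw [this]
        exact map_mem_stage ι t i _
      · change σ.symm (t j) ∈ _
        have hj' : (j : ℕ) < i := hj
        have ht := gen_mem_stage ι t i j hj'
        rcases h.steps j with hs | hs <;> obtain ⟨a, ha, ha0, hs⟩ := hs.shift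
        · have hb := stage_mono ι t hj'.le ((ih j hj').2 a ha)
          have : σ.symm (t j) = t j - σ.symm a := by
            rw [RingEquiv.symm_apply_eq, map_sub, hs, RingEquiv.apply_symm_apply]
            ring
          rw [this]
          exact sub_mem ht hb
        · have hb := stage_mono ι t hj'.le ((ih j hj').2 a ha)
          have : σ.symm (t j) = t j / σ.symm a := by
            rw [RingEquiv.symm_apply_eq, map_div₀, hs, RingEquiv.apply_symm_apply]
            field_simp
          rw [this]
          exact div_mem ht hb

/-- The automorphism of `G(t₁,…,tᵢ)` that is the restriction of `σ`. -/
def IsPiSigmaExt.stageAut {G E : Type u} [Field G] [Field E] {σG : G ≃+* G}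
    {σ : E ≃+* E} {ι : G →+* E} {n : ℕ} {t : Fin n → E} (h : IsPiSigmaExt σG σ ι t) (i : ℕ) :
    stage ι t i ≃+* stage ι t i where
  toFun x := ⟨σ x, (h.stage_stable i).1 x x.2⟩
  invFun x := ⟨σ.symm x, (h.stage_stable i).2 x x.2⟩
  left_inv x := Subtype.ext (σ.symm_apply_apply x)
  right_inv x := Subtype.ext (σ.apply_symm_apply x)
  map_mul' x y := Subtype.ext (map_mul σ (x : E) y)
  map_add' x y := Subtype.ext (map_add σ (x : E) y)

/-- The embedding of `G` into `G(t₁,…,tᵢ)`. -/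
def stageEmb {G E : Type u} [Field G] [Field E] (ι : G →+* E) {n : ℕ} (t : Fin n → E) (i : ℕ) :
    G →+* stage ι t i :=
  ι.codRestrict (stage ι t i) (map_mem_stage ι t i)

/-- The elements `t₁,…,tᵢ` of `G(t₁,…,tᵢ)`. -/
def stageGens {G E : Type u} [Field G] [Field E] (ι : G →+* E) {n : ℕ} (t : Fin n → E)
    (i : Fin n) : Fin i → stage ι t i :=
  fun j => ⟨t (Fin.castLE i.2.le j), gen_mem_stage ι t i _ j.2⟩

/-- `(E, σ)` with `E = G(t₁)…(tₙ)` is a depth-optimal `ΠΣ*`-extension (`ΠΣᵟ`-extension)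
of `(G, σG)`: it is a `ΠΣ*`-extension, and each `G(t₁,…,tᵢ)` for which `tᵢ` is a `Σ*`-extension
is a depth-optimal `Σ*`-extension of `G(t₁,…,tᵢ₋₁)`. -/
structure IsPiSigmaDeltaExt {G E : Type u} [Field G] [Field E] (σG : G ≃+* G) (σ : E ≃+* E)
    (ι : G →+* E) {n : ℕ} (t : Fin n → E) : Prop where
  isPiSigmaExt : IsPiSigmaExt σG σ ι t
  optimal : ∀ i : Fin n, IsSigmaStep σ (stage ι t i) (t i) →
    ∃ a : stage ι t i, IsSigmaDeltaStep (stageEmb ι t i) (stageGens ι t i)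
      (isPiSigmaExt.stageAut i) σ (stage ι t i).subtype (t i) a

/-! Every `Σ*`-extension is a `ΠΣ*`-extension, so the content is `exists_isSigmaExt`: a solution `g`
of `σ(g) - g = f` in a `ΠΣ*`-extension `E` of `F` must be replaced by one in a `Σ*`-extension of no
larger depth. The replacement is a subfield `L = F(y₁,…,y_q)` of `E` that contains `g`. If the
difference of `y ∈ E` lies in a stable subfield containing all constants, then `y` lies in that
subfield or is transcendental over it (`mem_of_not_transOver`). Since all constants of `E` come from
`G`, each new `y` therefore gives a `Σ*`-step. The difficulty is to bound the depth.

List all generators of `E` over `G` as `zᵢ`, those of `F` first, and grade them by depth. Let `M_k`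
be generated by the `zᵢ` of depth at most `k`. Induction on `k` (`exists_level`) produces elements
`y` of level at most `k` such that the field `K_k`, generated by them and the generators of `F` of
depth at most `k`, is closed under telescoping in `M_k`: if `g ∈ M_k` and `σ(g) - g ∈ K_k`, then `g
∈ K_k`. For the step, an element of `M_{k+1}` with difference in `M_k` is, modulo `M_k`, a linear
combination over the constants of the `Σ`-type generators of depth `k + 1`
(`stable_and_tow_adj_finset`). Hence the solutions in `M_{k+1}` of telescoping equations over `K_k`
are finite-dimensional modulo `M_k`, and finitely many of them, adjoined with level `k + 1`, capture
all.

That adjunctions leave no gaps is controlled by `PairExt`: for `(K', M')` over `(K, M)`, an element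
of `M'` with difference in `K' + M` lies in `K' + M`, and `K' ∩ M = K`. Closure then passes from
`(K, M)` to `(K', M')` (`PairExt.closed`). The property survives adjoining the same `y` to both
fields, by comparing coefficients of expansions at `y = ∞` (`exists_sub_mem_adj`,
`mem_adj_of_approx`). When `k` is the extension depth `d`, the generators of `E` beyond `F` lie in
`M_d`, and adjoining the deeper generators of `F` turns `(K_d, M_d)` into `(L, E)`. -/

/-! ### Rational functions in one variable, filtered by their degree at infinity. -/

section OneVariable

open Polynomial

variable {E : Type*} [Field E] {K M : Subfield E} {y x x' u u' c c' : E} {i j : ℤ}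

/-- The polynomials over `E` all of whose coefficients lie in the subfield `K`. -/
noncomputable def polyIn (K : Subfield E) : Subring E[X] := (mapRingHom K.subtype).range

theorem degree_C_mul_le_degree (c : E) (p : E[X]) : (C c * p).degree ≤ p.degree := by
  by_cases hc : c = 0
  · simp [hc]
  · rw [degree_C_mul hc]

theorem mem_polyIn {p : E[X]} : p ∈ polyIn K ↔ ∀ n, p.coeff n ∈ K := by
  rw [polyIn, mem_map_range]
  simp

theorem polyIn_mono (h : K ≤ M) : polyIn K ≤ polyIn M := fun _ hp =>
  mem_polyIn.2 fun n => h (mem_polyIn.1 hp n)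

theorem C_mem_polyIn (h : c ∈ K) : C c ∈ polyIn K :=
  ⟨C ⟨c, h⟩, by simp⟩

theorem X_mem_polyIn : (X : E[X]) ∈ polyIn K := ⟨X, by simp⟩

theorem comp_mem_polyIn {p q : E[X]} (hp : p ∈ polyIn K) (hq : q ∈ polyIn K) :
    p.comp q ∈ polyIn K := by
  obtain ⟨p, rfl⟩ := hp
  obtain ⟨q, rfl⟩ := hq
  exact ⟨p.comp q, by simp [Polynomial.map_comp]⟩

/-- `y` is transcendental over `K`, stated with polynomials over `E`. -/
def TransOver (K : Subfield E) (y : E) : Prop := ∀ p ∈ polyIn K, eval y p = 0 → p = 0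

theorem transOver_iff : TransOver K y ↔ Transcendental K y := by
  rw [transcendental_iff]
  constructor
  · intro h p hp
    have := h (p.map K.subtype) ⟨p, rfl⟩ (by rw [eval_map]; exact hp)
    exact (Polynomial.map_eq_zero _).1 this
  · rintro h _ ⟨p, rfl⟩ hp
    have : p = 0 := h p (by rw [coe_mapRingHom, eval_map] at hp; exact hp)
    simp [this]

theorem TransOver.mono (h : TransOver M y) (hKM : K ≤ M) : TransOver K y :=
  fun p hp => h p (polyIn_mono hKM hp)

theorem TransOver.notMem (h : TransOver M y) : y ∉ M := fun hy =>
  X_sub_C_ne_zero y (h _ (sub_mem X_mem_polyIn (C_mem_polyIn hy)) (by simp))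

theorem TransOver.ne_zero (h : TransOver M y) : y ≠ 0 := fun hy => h.notMem (hy ▸ zero_mem M)

theorem TransOver.eval_ne (h : TransOver M y) {q : E[X]} (hq : q ∈ polyIn M) (h0 : q ≠ 0) :
    eval y q ≠ 0 := fun he => h0 (h q hq he)

/-- The subfield generated by `K` and `S`. -/
def adj (K : Subfield E) (S : Set E) : Subfield E := Subfield.closure (K ∪ S)

theorem le_adj (S : Set E) : K ≤ adj K S := fun _ hx => Subfield.subset_closure (Or.inl hx)

theorem mem_adj_of_mem {S : Set E} (h : x ∈ S) : x ∈ adj K S := Subfield.subset_closure (Or.inr h)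

theorem mem_adj_self : y ∈ adj K {y} := mem_adj_of_mem rfl

theorem adj_le {S : Set E} (h : K ≤ M) (hS : S ⊆ M) : adj K S ≤ M :=
  Subfield.closure_le.2 (Set.union_subset h hS)

theorem adj_mono {S T : Set E} (h : K ≤ M) (hS : S ⊆ T) : adj K S ≤ adj M T :=
  adj_le (h.trans (le_adj _)) fun _ hx => mem_adj_of_mem (hS hx)

theorem adj_adj (K : Subfield E) (S T : Set E) : adj (adj K S) T = adj K (S ∪ T) :=
  le_antisymm
    (adj_le (adj_mono le_rfl Set.subset_union_left) fun _ hx => mem_adj_of_mem (Or.inr hx))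
    (adj_le ((le_adj S).trans (le_adj T))
      (Set.union_subset (fun _ hx => le_adj T (mem_adj_of_mem hx)) fun _ hx => mem_adj_of_mem hx))

theorem adj_eq_self {S : Set E} (h : S ⊆ K) : adj K S = K :=
  le_antisymm (adj_le le_rfl h) (le_adj S)

theorem eval_mem_of_polyIn {p : E[X]} (hp : p ∈ polyIn K) (hy : y ∈ K) : eval y p ∈ K := by
  obtain ⟨p, rfl⟩ := hp
  have : eval y (p.map K.subtype) = K.subtype (eval ⟨y, hy⟩ p) := by
    rw [eval_map, ← eval₂_hom]; rfl
  rw [coe_mapRingHom, this]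
  exact (eval _ p).2

theorem mem_adj_singleton : x ∈ adj K {y} ↔
    ∃ p ∈ polyIn K, ∃ q ∈ polyIn K, eval y q ≠ 0 ∧ x = eval y p / eval y q := by
  constructor
  · intro h
    induction h using Subfield.closure_induction with
    | mem x hx =>
      rcases hx with hx | rfl
      · exact ⟨C x, C_mem_polyIn hx, 1, one_mem _, by simp, by simp⟩
      · exact ⟨X, X_mem_polyIn, 1, one_mem _, by simp, by simp⟩
    | one => exact ⟨1, one_mem _, 1, one_mem _, by simp, by simp⟩
    | add a b _ _ ha hb =>
      obtain ⟨p, hp, q, hq, h0, rfl⟩ := ha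
      obtain ⟨p', hp', q', hq', h0', rfl⟩ := hb
      exact ⟨p * q' + q * p', add_mem (mul_mem hp hq') (mul_mem hq hp'), q * q', mul_mem hq hq',
        by simp [h0, h0'], by simp [div_add_div _ _ h0 h0']⟩
    | neg a _ ha =>
      obtain ⟨p, hp, q, hq, h0, rfl⟩ := ha
      exact ⟨-p, neg_mem hp, q, hq, h0, by simp [neg_div]⟩
    | inv a _ ha =>
      obtain ⟨p, hp, q, hq, h0, rfl⟩ := ha
      by_cases hp0 : eval y p = 0
      · exact ⟨0, zero_mem _, 1, one_mem _, by simp, by simp [hp0]⟩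
      · exact ⟨q, hq, p, hp, hp0, by simp⟩
    | mul a b _ _ ha hb =>
      obtain ⟨p, hp, q, hq, h0, rfl⟩ := ha
      obtain ⟨p', hp', q', hq', h0', rfl⟩ := hb
      exact ⟨p * p', mul_mem hp hp', q * q', mul_mem hq hq', by simp [h0, h0'],
        by simp [div_mul_div_comm]⟩
  · rintro ⟨p, hp, q, hq, -, rfl⟩
    exact div_mem (eval_mem_of_polyIn (polyIn_mono (le_adj _) hp) mem_adj_self)
      (eval_mem_of_polyIn (polyIn_mono (le_adj _) hq) mem_adj_self)

/-- `x` is a proper fraction `p(y) / q(y)` with `deg p < deg q` over `M`. -/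
def ProperFrac (M : Subfield E) (y x : E) : Prop :=
  ∃ p ∈ polyIn M, ∃ q ∈ polyIn M, p.degree < q.degree ∧ x * eval y q = eval y p

theorem ProperFrac.zero : ProperFrac M y 0 :=
  ⟨0, zero_mem _, 1, one_mem _, by simp, by simp⟩

theorem ProperFrac.neg (h : ProperFrac M y x) : ProperFrac M y (-x) := by
  obtain ⟨p, hp, q, hq, hd, h⟩ := h
  exact ⟨-p, neg_mem hp, q, hq, by simpa using hd, by simp [← h]⟩

theorem ne_bot_of_degree_lt {p q : E[X]} (h : p.degree < q.degree) : q.degree ≠ ⊥ :=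
  ne_bot_of_gt h

theorem ProperFrac.add (h : ProperFrac M y x) (h' : ProperFrac M y x') :
    ProperFrac M y (x + x') := by
  obtain ⟨p, hp, q, hq, hd, h⟩ := h
  obtain ⟨p', hp', q', hq', hd', h'⟩ := h'
  refine ⟨p * q' + q * p', add_mem (mul_mem hp hq') (mul_mem hq hp'), q * q', mul_mem hq hq', ?_, ?_⟩
  · refine (degree_add_le _ _).trans_lt (max_lt ?_ ?_)
    · rw [degree_mul, degree_mul]
      exact WithBot.add_lt_add_right (ne_bot_of_degree_lt hd') hd
    · rw [degree_mul, degree_mul]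
      exact WithBot.add_lt_add_left (ne_bot_of_degree_lt hd) hd'
  · simp only [eval_mul, eval_add, ← h, ← h']; ring

theorem ProperFrac.sub (h : ProperFrac M y x) (h' : ProperFrac M y x') :
    ProperFrac M y (x - x') := by
  rw [sub_eq_add_neg]; exact h.add h'.neg

theorem ProperFrac.mul (h : ProperFrac M y x) (h' : ProperFrac M y x') :
    ProperFrac M y (x * x') := by
  obtain ⟨p, hp, q, hq, hd, h⟩ := h
  obtain ⟨p', hp', q', hq', hd', h'⟩ := h'
  refine ⟨p * p', mul_mem hp hp', q * q', mul_mem hq hq', ?_, ?_⟩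
  · rw [degree_mul, degree_mul]
    exact (add_le_add_right hd'.le _).trans_lt
      (WithBot.add_lt_add_right (ne_bot_of_degree_lt hd') hd)
  · simp only [eval_mul, ← h, ← h']; ring

theorem ProperFrac.const_mul (hc : c ∈ M) (h : ProperFrac M y x) : ProperFrac M y (c * x) := by
  obtain ⟨p, hp, q, hq, hd, h⟩ := h
  refine ⟨C c * p, mul_mem (C_mem_polyIn hc) hp, q, hq, (degree_C_mul_le_degree _ _).trans_lt hd, ?_⟩
  simp only [eval_mul, eval_C, ← h]; ring

theorem ProperFrac.inv_var (hy : TransOver M y) : ProperFrac M y y⁻¹ :=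
  ⟨1, one_mem _, X, X_mem_polyIn, by simp, by simp [hy.ne_zero]⟩

theorem ProperFrac.eq_zero_of_mem (hy : TransOver M y) (hc : c ∈ M) (h : ProperFrac M y c) :
    c = 0 := by
  obtain ⟨p, hp, q, hq, hd, h⟩ := h
  have := hy (C c * q - p) (sub_mem (mul_mem (C_mem_polyIn hc) hq) hp) (by simp [h])
  by_contra hc0
  have h2 : (C c * q).degree = q.degree := degree_C_mul hc0
  rw [sub_eq_zero.1 this] at h2
  exact hd.ne h2

/-- `u ≡ c` modulo proper fractions, with `c ∈ M`. -/
def Residue (M : Subfield E) (y u c : E) : Prop := c ∈ M ∧ ProperFrac M y (u - c)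

theorem Residue.mul (h : Residue M y u c) (h' : Residue M y u' c') :
    Residue M y (u * u') (c * c') := by
  refine ⟨mul_mem h.1 h'.1, ?_⟩
  have : u * u' - c * c' = (u - c) * (u' - c') + c * (u' - c') + c' * (u - c) := by ring
  rw [this]
  exact ((h.2.mul h'.2).add (h'.2.const_mul h.1)).add (h.2.const_mul h'.1)

theorem Residue.add (h : Residue M y u c) (h' : Residue M y u' c') :
    Residue M y (u + u') (c + c') := by
  refine ⟨add_mem h.1 h'.1, ?_⟩
  rw [add_sub_add_comm]
  exact h.2.add h'.2

theorem Residue.const (h : c ∈ M) : Residue M y c c := ⟨h, by rw [sub_self]; exact .zero⟩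

theorem ProperFrac.residue (h : ProperFrac M y x) : Residue M y x 0 :=
  ⟨zero_mem _, by simpa using h⟩

theorem Residue.properFrac (h : Residue M y u 0) : ProperFrac M y u := by simpa using h.2

theorem Residue.sub (h : Residue M y u c) (h' : Residue M y u' c') :
    Residue M y (u - u') (c - c') := by
  refine ⟨sub_mem h.1 h'.1, ?_⟩
  rw [sub_sub_sub_comm]
  exact h.2.sub h'.2

theorem Residue.mul_properFrac (h : Residue M y u c) (hx : ProperFrac M y x) :
    ProperFrac M y (u * x) := by
  have := (h.mul hx.residue)
  rw [mul_zero] at this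
  exact this.properFrac

theorem Residue.inv (hy : TransOver M y) (h : Residue M y u c) (hc : c ≠ 0) :
    Residue M y u⁻¹ c⁻¹ := by
  obtain ⟨hcM, p, hp, q, hq, hd, h⟩ := h
  refine ⟨inv_mem hcM, -C c⁻¹ * p, mul_mem (neg_mem (C_mem_polyIn (inv_mem hcM))) hp,
    C c * q + p, add_mem (mul_mem (C_mem_polyIn hcM) hq) hp, ?_, ?_⟩
  · have hdq : (C c * q).degree = q.degree := degree_C_mul hc
    rw [degree_add_eq_left_of_degree_lt (by rwa [hdq]), hdq, ← C_neg]
    exact (degree_C_mul_le_degree _ _).trans_lt hd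
  · have hu : u * eval y q = c * eval y q + eval y p := by rw [← h]; ring
    have hq0 : q ≠ 0 := fun h0 => by simp [h0] at hd
    have hdq : (C c * q).degree = q.degree := degree_C_mul hc
    have h0 : eval y (C c * q + p) ≠ 0 := by
      refine hy.eval_ne (add_mem (mul_mem (C_mem_polyIn hcM) hq) hp) fun h0 => ?_
      have := degree_add_eq_left_of_degree_lt (p := C c * q) (q := p) (by rwa [hdq])
      rw [h0, hdq] at this
      exact hq0 (degree_eq_bot.1 (by simpa using this.symm))
    have hu0 : u ≠ 0 := fun h1 => h0 (by simp [← hu, h1])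
    simp only [eval_add, eval_mul, eval_C, eval_neg, ← h]
    field_simp
    ring

theorem Residue.zpow (hy : TransOver M y) (h : Residue M y u c) (hc : c ≠ 0) (i : ℤ) :
    Residue M y (u ^ i) (c ^ i) := by
  have hn : ∀ n : ℕ, Residue M y (u ^ n) (c ^ n) := by
    intro n
    induction n with
    | zero => simpa using Residue.const (one_mem M)
    | succ n ih => rw [pow_succ, pow_succ]; exact ih.mul h
  obtain ⟨n, rfl | rfl⟩ := i.eq_nat_or_neg
  · simpa using hn n
  · simpa using (hn n).inv hy (pow_ne_zero n hc)

/-- The filtration of `M(y)` by the degree in `y`: `x` has degree less than `i`. -/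
def DegLT (M : Subfield E) (y : E) (i : ℤ) (x : E) : Prop := ProperFrac M y (x * y ^ (-i))

theorem DegLT.zero : DegLT M y i 0 := by rw [DegLT, zero_mul]; exact .zero

theorem DegLT.add (h : DegLT M y i x) (h' : DegLT M y i x') : DegLT M y i (x + x') := by
  rw [DegLT, add_mul]; exact ProperFrac.add h h'

theorem DegLT.sub (h : DegLT M y i x) (h' : DegLT M y i x') : DegLT M y i (x - x') := by
  rw [DegLT, sub_mul]; exact ProperFrac.sub h h'

theorem DegLT.const_mul (hc : c ∈ M) (h : DegLT M y i x) : DegLT M y i (c * x) := by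
  rw [DegLT, mul_assoc]; exact ProperFrac.const_mul hc h

theorem properFrac_zpow (hy : TransOver M y) (h : i < 0) : ProperFrac M y (y ^ i) := by
  obtain ⟨n, rfl⟩ : ∃ n : ℕ, i = -(n + 1) := ⟨(-i - 1).toNat, by omega⟩
  induction n with
  | zero => simpa using ProperFrac.inv_var hy
  | succ n ih =>
    have : (-((n + 1 : ℕ) + 1) : ℤ) = -(n + 1) + -1 := by push_cast; ring
    rw [this, zpow_add₀ hy.ne_zero, zpow_neg_one]
    exact (ih (by omega)).mul (.inv_var hy)

theorem DegLT.mono (hy : TransOver M y) (h : DegLT M y i x) (hij : i ≤ j) : DegLT M y j x := by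
  rcases hij.eq_or_lt with rfl | hij
  · exact h
  · have : x * y ^ (-j) = x * y ^ (-i) * y ^ (i - j) := by
      rw [mul_assoc, ← zpow_add₀ hy.ne_zero]; congr 2; ring
    rw [DegLT, this]
    exact ProperFrac.mul h (properFrac_zpow hy (by omega))

theorem DegLT.monomial (hy : TransOver M y) (hc : c ∈ M) (h : j < i) :
    DegLT M y i (c * y ^ j) := by
  rw [DegLT, mul_assoc, ← zpow_add₀ hy.ne_zero]
  exact (properFrac_zpow hy (by omega)).const_mul hc

theorem DegLT.const (hy : TransOver M y) (hc : c ∈ M) (h : 0 < i) : DegLT M y i c := by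
  simpa using DegLT.monomial hy hc h

theorem DegLT.coeff_eq_zero (hy : TransOver M y) (hc : c ∈ M) (h : DegLT M y i (c * y ^ i)) :
    c = 0 := by
  rw [DegLT, mul_assoc, ← zpow_add₀ hy.ne_zero, add_neg_cancel, zpow_zero, mul_one] at h
  exact h.eq_zero_of_mem hy hc

/-- If `x y^(-i-1) = p/q` is proper, then `x y^(-i) = Xp/q`, and its value at infinity is the
coefficient of `Xp` in degree `deg q` over the leading coefficient of `q`. -/
theorem DegLT.exists_lead (hy : TransOver M y) (h : DegLT M y (i + 1) x) :
    ∃ w ∈ M, DegLT M y i (x - w * y ^ i) := by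
  obtain ⟨p, hp, q, hq, hd, h⟩ := h
  have hq0 : q ≠ 0 := fun h0 => by simp [h0] at hd
  have hl : q.leadingCoeff ≠ 0 := leadingCoeff_ne_zero.2 hq0
  set w := (X * p).coeff q.natDegree / q.leadingCoeff with hw
  have hwM : w ∈ M := div_mem (mem_polyIn.1 (mul_mem X_mem_polyIn hp) _) (mem_polyIn.1 hq _)
  refine ⟨w, hwM, X * p - C w * q, sub_mem (mul_mem X_mem_polyIn hp)
    (mul_mem (C_mem_polyIn hwM) hq), q, hq, ?_, ?_⟩
  · rw [degree_eq_natDegree hq0, degree_lt_iff_coeff_zero]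
    intro m hm
    rcases hm.eq_or_lt with rfl | hm
    · simp only [coeff_sub, coeff_C_mul, coeff_natDegree, hw]
      field_simp; simp
    · have h1 : (C w * q).coeff m = 0 := by
        rw [coeff_C_mul, coeff_eq_zero_of_natDegree_lt hm, mul_zero]
      obtain ⟨k, rfl⟩ : ∃ k, m = k + 1 := ⟨m - 1, by omega⟩
      have h2 : (X * p).coeff (k + 1) = 0 := by
        rw [coeff_X_mul]
        refine coeff_eq_zero_of_degree_lt (hd.trans_le ?_)
        rw [degree_eq_natDegree hq0]
        exact_mod_cast (by omega : q.natDegree ≤ k)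
      rw [coeff_sub, h1, h2, sub_zero]
  · simp only [eval_sub, eval_mul, eval_X, eval_C, ← h]
    have hy0 := hy.ne_zero
    rw [sub_mul, mul_assoc w, ← zpow_add₀ hy0, add_neg_cancel, zpow_zero,
      show -i = -(i + 1) + 1 by ring, zpow_add₀ hy0, zpow_one]
    ring

theorem DegLT.exists_of_mem (hy : TransOver M y) (h : x ∈ adj M {y}) :
    ∃ n : ℕ, DegLT M y n x := by
  obtain ⟨p, hp, q, hq, h0, rfl⟩ := mem_adj_singleton.1 h
  have hq0 : q ≠ 0 := fun h => h0 (by simp [h])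
  refine ⟨p.natDegree + 1, p, hp, X ^ (p.natDegree + 1) * q,
    mul_mem (pow_mem X_mem_polyIn _) hq, ?_, ?_⟩
  · rw [degree_mul, degree_X_pow, degree_eq_natDegree hq0]
    refine degree_le_natDegree.trans_lt ?_
    exact_mod_cast (by omega : p.natDegree < p.natDegree + 1 + q.natDegree)
  · have := hy.ne_zero
    simp only [eval_mul, eval_pow, eval_X, zpow_neg, zpow_natCast]
    field_simp

/-- A nonzero `p/q` has degree `deg p - deg q ≥ -deg q`, so the single order `n = deg q` already
gives a contradiction. -/
theorem eq_zero_of_forall_degLT (hy : TransOver M y) (h : x ∈ adj M {y})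
    (hx : ∀ n : ℕ, DegLT M y (-n) x) : x = 0 := by
  obtain ⟨p, hp, q, hq, h0, rfl⟩ := mem_adj_singleton.1 h
  have hq0 : q ≠ 0 := fun h => h0 (by simp [h])
  obtain ⟨p', hp', q', hq', hd, he⟩ := hx q.natDegree
  by_contra hne
  have hp0 : p ≠ 0 := fun h => hne (by simp [h])
  have hq0' : q' ≠ 0 := fun h0 => by simp [h0] at hd
  have : p * X ^ q.natDegree * q' = p' * q := by
    rw [← sub_eq_zero]
    refine hy _ (sub_mem (mul_mem (mul_mem hp (pow_mem X_mem_polyIn _)) hq') (mul_mem hp' hq)) ?_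
    simp only [eval_sub, eval_mul, eval_pow, eval_X, ← he, neg_neg, zpow_natCast]
    field_simp
    ring
  have hd2 := congrArg degree this
  rw [degree_mul, degree_mul, degree_mul, degree_X_pow, degree_eq_natDegree hp0,
    degree_eq_natDegree hq0', degree_eq_natDegree hq0] at hd2
  rw [degree_eq_natDegree hq0'] at hd
  have hp0' : p' ≠ 0 := by
    rintro rfl
    rw [zero_mul] at this
    exact mul_ne_zero (mul_ne_zero hp0 (pow_ne_zero _ X_ne_zero)) hq0' this
  rw [degree_eq_natDegree hp0'] at hd hd2
  norm_cast at hd hd2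
  omega

/-- Writing `x y^(-i) = p/q` over `K`, the value at infinity is a quotient of coefficients of `p`
and `q`. Transcendence over `M` forces `c ∈ M` to be this value. -/
theorem coeff_mem (hKM : K ≤ M) (hy : TransOver M y) (hx : x ∈ adj K {y}) (hc : c ∈ M)
    (h : DegLT M y i (x - c * y ^ i)) : c ∈ K := by
  have hy0 := hy.ne_zero
  have hx' : x * y ^ (-i) ∈ adj K {y} := mul_mem hx (zpow_mem mem_adj_self _)
  obtain ⟨p, hp, q, hq, h0, hpq⟩ := mem_adj_singleton.1 hx'
  have hq0 : q ≠ 0 := fun h => h0 (by simp [h])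
  obtain ⟨p', hp', q', hq', hd, he⟩ := h
  have hq0' : q' ≠ 0 := fun h0 => by simp [h0] at hd
  rw [sub_mul, mul_assoc c, ← zpow_add₀ hy0, add_neg_cancel, zpow_zero, mul_one, hpq] at he
  have : (p - C c * q) * q' = p' * q := by
    rw [← sub_eq_zero]
    refine hy _ (sub_mem (mul_mem (sub_mem (polyIn_mono hKM hp) (mul_mem (C_mem_polyIn hc)
      (polyIn_mono hKM hq))) hq') (mul_mem hp' (polyIn_mono hKM hq))) ?_
    simp only [eval_sub, eval_mul, eval_C, ← he]
    field_simp
    ring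
  have hlt : (p - C c * q).degree < q.degree := by
    by_contra! hge
    have := congrArg degree this
    rw [degree_mul, degree_mul] at this
    have h1 : p'.degree + q.degree < q'.degree + q.degree :=
      WithBot.add_lt_add_right (by rwa [Ne, degree_eq_bot]) hd
    rw [← this, add_comm q'.degree] at h1
    exact absurd h1 (not_lt.2 (add_le_add_left hge _))
  have hz := coeff_eq_zero_of_degree_lt (n := q.natDegree)
    (by rwa [← degree_eq_natDegree hq0] : (p - C c * q).degree < _)
  rw [coeff_sub, coeff_C_mul, sub_eq_zero] at hz
  have : c = p.coeff q.natDegree / q.leadingCoeff := by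
    rw [hz]; field_simp [leadingCoeff_ne_zero.2 hq0]; simp
  rw [this]
  exact div_mem (mem_polyIn.1 hp _) (mem_polyIn.1 hq _)

end OneVariable

/-! ### Descent of rationality from `M(y)` to `K(y)`. -/

section Closing

open Polynomial

variable {E : Type*} [Field E] {K M : Subfield E} {y x : E}

theorem properFrac_div_iff (hy : TransOver M y) {p q : E[X]} (hp : p ∈ polyIn M)
    (hq : q ∈ polyIn M) (hq0 : q ≠ 0) :
    ProperFrac M y (eval y p / eval y q) ↔ p.degree < q.degree := by
  have h0 := hy.eval_ne hq hq0
  constructor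
  · rintro ⟨p', hp', q', hq', hd, he⟩
    have hq0' : q' ≠ 0 := fun h0 => by simp [h0] at hd
    have : p * q' = p' * q := by
      rw [← sub_eq_zero]
      refine hy _ (sub_mem (mul_mem hp hq') (mul_mem hp' hq)) ?_
      simp only [eval_sub, eval_mul, ← he]
      field_simp
      ring
    by_contra! hge
    have hd2 := congrArg degree this
    rw [degree_mul, degree_mul] at hd2
    have h1 : p'.degree + q.degree < q'.degree + q.degree :=
      WithBot.add_lt_add_right (by rwa [Ne, degree_eq_bot]) hd
    rw [← hd2, add_comm q'.degree] at h1
    exact absurd h1 (not_lt.2 (add_le_add_left hge _))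
  · intro h
    exact ⟨p, hp, q, hq, h, by field_simp⟩

theorem exists_coeff_eq (f : E → E) (hf : f 0 = 0) (p : E[X]) :
    ∃ p' : E[X], ∀ n, p'.coeff n = f (p.coeff n) := by
  refine ⟨∑ n ∈ p.support, monomial n (f (p.coeff n)), fun n => ?_⟩
  rw [finsetSum_coeff]
  simp only [coeff_monomial]
  rw [Finset.sum_ite_eq' p.support n]
  split_ifs with h
  · rfl
  · rw [notMem_support_iff.1 h, hf]

/-- An element of `M(y)` that is approximated to any order by elements of `K(y)` lies in `K(y)`. -/
theorem mem_adj_of_approx (hKM : K ≤ M) (hy : TransOver M y) (hx : x ∈ adj M {y})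
    (h : ∀ n : ℕ, ∃ k ∈ adj K {y}, DegLT M y (-n) (x - k)) : x ∈ adj K {y} := by
  obtain ⟨p, hp, q, hq, h0, rfl⟩ := mem_adj_singleton.1 hx
  have hq0 : q ≠ 0 := fun h => h0 (by simp [h])
  -- A `K`-linear functional applied to all coefficients turns `p`, `q` into polynomials `p'`, `q'`
  -- over `K`, and `φ ≠ 0` at the leading coefficient of `q` preserves `deg q`. It commutes with
  -- multiplication by polynomials over `K`, so any approximation `l/d` from `K(y)` of `p/q` also
  -- approximates `p'/q'` to the same order. Hence the two fractions agree.
  obtain ⟨φ, hφ⟩ : ∃ φ : Module.Dual K E, φ q.leadingCoeff ≠ 0 := by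
    by_contra! hc
    exact leadingCoeff_ne_zero.2 hq0 ((Module.forall_dual_apply_eq_zero_iff K _).1 hc)
  obtain ⟨p', hp'⟩ := exists_coeff_eq (fun e => (φ e : E)) (by simp) p
  obtain ⟨q', hq'⟩ := exists_coeff_eq (fun e => (φ e : E)) (by simp) q
  have hp'K : p' ∈ polyIn K := mem_polyIn.2 fun n => by rw [hp']; exact (φ _).2
  have hq'K : q' ∈ polyIn K := mem_polyIn.2 fun n => by rw [hq']; exact (φ _).2
  have hdeg : q'.degree = q.degree := by
    refine le_antisymm ?_ ?_
    · rw [degree_le_iff_coeff_zero]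
      intro m hm
      rw [hq', coeff_eq_zero_of_degree_lt hm]
      simp
    · rw [degree_eq_natDegree hq0]
      refine le_degree_of_ne_zero ?_
      rw [hq', coeff_natDegree]
      exact_mod_cast hφ
  have hq0' : q' ≠ 0 := fun h => hq0 (by rw [← degree_eq_bot, ← hdeg, h, degree_zero])
  have hq'M := polyIn_mono hKM hq'K
  have h0' := hy.eval_ne hq'M hq0'
  have hmulφ : ∀ r r' d : E[X], d ∈ polyIn K → (∀ n, r'.coeff n = φ (r.coeff n)) →
      ∀ n, (r' * d).coeff n = φ ((r * d).coeff n) := by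
    intro r r' d hd hr n
    rw [coeff_mul, coeff_mul, map_sum, AddSubmonoidClass.coe_finsetSum]
    refine Finset.sum_congr rfl fun i _ => ?_
    have : r.coeff i.1 * d.coeff i.2 = (⟨_, mem_polyIn.1 hd i.2⟩ : K) • r.coeff i.1 :=
      mul_comm _ _
    rw [hr, this, map_smul, smul_eq_mul]
    push_cast
    ring
  suffices eval y p / eval y q - eval y p' / eval y q' = 0 by
    rw [sub_eq_zero.1 this]
    exact mem_adj_singleton.2 ⟨p', hp'K, q', hq'K, h0', rfl⟩
  refine eq_zero_of_forall_degLT hy (sub_mem hx (adj_mono hKM le_rfl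
    (mem_adj_singleton.2 ⟨p', hp'K, q', hq'K, h0', rfl⟩))) fun n => ?_
  obtain ⟨k, hk, hkn⟩ := h n
  have key : DegLT M y (-n) (eval y p' / eval y q' - k) := by
    obtain ⟨l, hl, d, hd, hd0, rfl⟩ := mem_adj_singleton.1 hk
    have hd0' : d ≠ 0 := fun h => hd0 (by simp [h])
    have hlM := polyIn_mono hKM hl
    have hdM := polyIn_mono hKM hd
    have e1 : (eval y p / eval y q - eval y l / eval y d) * y ^ (-(-n : ℤ)) =
        eval y ((p * d - q * l) * X ^ n) / eval y (q * d) := by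
      simp only [eval_mul, eval_sub, eval_pow, eval_X, neg_neg, zpow_natCast]
      field_simp
    have e2 : (eval y p' / eval y q' - eval y l / eval y d) * y ^ (-(-n : ℤ)) =
        eval y ((p' * d - q' * l) * X ^ n) / eval y (q' * d) := by
      simp only [eval_mul, eval_sub, eval_pow, eval_X, neg_neg, zpow_natCast]
      field_simp
    rw [DegLT, e1, properFrac_div_iff hy (mul_mem (sub_mem (mul_mem hp hdM) (mul_mem hq hlM))
      (pow_mem X_mem_polyIn _)) (mul_mem hq hdM) (mul_ne_zero hq0 hd0')] at hkn
    rw [DegLT, e2, properFrac_div_iff hy (mul_mem (sub_mem (mul_mem (polyIn_mono hKM hp'K) hdM)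
      (mul_mem hq'M hlM)) (pow_mem X_mem_polyIn _)) (mul_mem hq'M hdM) (mul_ne_zero hq0' hd0'),
      show (q' * d).degree = (q * d).degree by rw [degree_mul, degree_mul, hdeg]]
    refine lt_of_le_of_lt ?_ hkn
    rw [degree_mul, degree_mul]
    refine add_le_add_left ?_ _
    rw [degree_le_iff_coeff_zero]
    intro m hm
    rw [coeff_sub, hmulφ _ _ d hd hp', hmulφ _ _ l hl hq', ← Subfield.coe_sub, ← map_sub,
      ← coeff_sub, coeff_eq_zero_of_degree_lt hm]
    simp
  have := hkn.sub key
  rwa [sub_sub_sub_cancel_right] at this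

end Closing

/-! ### Difference equations in `M(y)` with `σ(y) = αy + a`, by comparison of coefficients. -/

section Automorphism

open Polynomial

variable {E : Type*} [Field E] {K M : Subfield E} {σ : E ≃+* E} {y x α a β : E} {i : ℤ}

/-- The subfield `K` is mapped onto itself by `σ`. -/
def Stable (σ : E ≃+* E) (K : Subfield E) : Prop := ∀ x, σ x ∈ K ↔ x ∈ K

/-- `y` is sent to `α y + a` by `σ`, with `α ∈ K` nonzero and `a ∈ K`. -/
structure Affine (σ : E ≃+* E) (K : Subfield E) (y α a : E) : Prop where
  mul_mem : α ∈ K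
  mul_ne : α ≠ 0
  add_mem : a ∈ K
  map_eq : σ y = α * y + a

theorem Affine.mono (h : Affine σ K y α a) (hKM : K ≤ M) : Affine σ M y α a :=
  ⟨hKM h.1, h.2, hKM h.3, h.4⟩

theorem Stable.symm_mem (h : Stable σ K) (hx : x ∈ K) : σ.symm x ∈ K :=
  (h _).1 (by simpa using hx)

theorem Stable.of_forall (h : ∀ x ∈ K, σ x ∈ K) (h' : ∀ x ∈ K, σ.symm x ∈ K) : Stable σ K :=
  fun x => ⟨fun hx => by simpa using h' _ hx, h x⟩

theorem Stable.adj_set (h : Stable σ K) {S : Set E} (hS : ∀ y ∈ S, σ y ∈ adj K S)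
    (hS' : ∀ y ∈ S, σ.symm y ∈ adj K S) : Stable σ (adj K S) := by
  have key : ∀ τ : E →+* E, (∀ y ∈ K, τ y ∈ K) → (∀ y ∈ S, τ y ∈ adj K S) →
      ∀ x ∈ adj K S, τ x ∈ adj K S := by
    intro τ h1 h2 x hx
    have : adj K S ≤ (adj K S).comap τ :=
      adj_le (fun y hy => le_adj S (h1 y hy)) h2
    exact this hx
  exact .of_forall (key σ.toRingHom (fun y hy => (h y).2 hy) hS)
    (key σ.symm.toRingHom (fun y hy => h.symm_mem hy) hS')

theorem Affine.symm_eq (hA : Affine σ K y α a) : σ.symm y = (y - σ.symm a) / σ.symm α := by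
  have : σ.symm α ≠ 0 := by simpa using hA.mul_ne
  rw [RingEquiv.symm_apply_eq, map_div₀, map_sub, hA.map_eq]
  simp [hA.mul_ne]

theorem Stable.adj_singleton (h : Stable σ K) (hA : Affine σ K y α a) : Stable σ (adj K {y}) := by
  refine h.adj_set ?_ ?_
  · rintro _ rfl
    rw [hA.map_eq]
    exact add_mem (mul_mem (le_adj _ hA.mul_mem) mem_adj_self) (le_adj _ hA.add_mem)
  · rintro _ rfl
    rw [hA.symm_eq]
    exact div_mem (sub_mem mem_adj_self (le_adj _ (h.symm_mem hA.add_mem)))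
      (le_adj _ (h.symm_mem hA.mul_mem))

/-- Applying `σ` to the coefficients and substituting `αX + a` with `α ≠ 0` preserves degrees. -/
theorem ProperFrac.map (hM : Stable σ M) (hy : TransOver M y) (hA : Affine σ M y α a)
    (h : ProperFrac M y x) : ProperFrac M y (σ x) := by
  obtain ⟨p, hp, q, hq, hd, h⟩ := h
  have hq0 : q ≠ 0 := fun h0 => by simp [h0] at hd
  have hl : C α * X + C a ∈ polyIn M :=
    add_mem (mul_mem (C_mem_polyIn hA.mul_mem) X_mem_polyIn) (C_mem_polyIn hA.add_mem)
  have hmem : ∀ p ∈ polyIn M, (p.map (σ : E →+* E)).comp (C α * X + C a) ∈ polyIn M :=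
    fun p hp => comp_mem_polyIn (mem_polyIn.2 fun n => by
      rw [coeff_map]; exact (hM _).2 (mem_polyIn.1 hp n)) hl
  have hev : ∀ p : E[X], eval y ((p.map (σ : E →+* E)).comp (C α * X + C a)) = σ (eval y p) := by
    intro p
    have : eval₂ (σ : E →+* E) ((σ : E →+* E) y) p = (σ : E →+* E) (eval y p) := eval₂_hom _ _
    rw [eval_comp, eval_map]
    simp only [eval_add, eval_mul, eval_C, eval_X, ← hA.map_eq]
    exact this
  have hnd : ∀ p : E[X], ((p.map (σ : E →+* E)).comp (C α * X + C a)).natDegree = p.natDegree := by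
    intro p
    rw [natDegree_comp, natDegree_linear hA.mul_ne, mul_one,
      natDegree_map_eq_of_injective σ.injective]
  refine ⟨_, hmem p hp, _, hmem q hq, ?_, ?_⟩
  · have hq1 : (q.map (σ : E →+* E)).comp (C α * X + C a) ≠ 0 := by
      intro h0
      have := hev q
      rw [h0, eval_zero] at this
      exact hy.eval_ne hq hq0 (σ.map_eq_zero_iff.1 this.symm)
    by_cases hp1 : (p.map (σ : E →+* E)).comp (C α * X + C a) = 0
    · rw [hp1, degree_zero, bot_lt_iff_ne_bot, Ne, degree_eq_bot]
      exact hq1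
    · have hp0 : p ≠ 0 := by rintro rfl; simp at hp1
      rw [degree_eq_natDegree hp1, degree_eq_natDegree hq1, hnd, hnd]
      rwa [degree_eq_natDegree hp0, degree_eq_natDegree hq0] at hd
  · rw [hev, hev, ← h, map_mul]

theorem residue_map_div (hy : TransOver M y) (hA : Affine σ M y α a) :
    Residue M y (σ y / y) α := by
  refine ⟨hA.mul_mem, ?_⟩
  have : σ y / y - α = a * y⁻¹ := by
    rw [hA.map_eq]; field_simp [hy.ne_zero]; ring
  rw [this]
  exact (ProperFrac.inv_var hy).const_mul hA.add_mem

theorem DegLT.map (hM : Stable σ M) (hy : TransOver M y) (hA : Affine σ M y α a)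
    (h : DegLT M y i x) : DegLT M y i (σ x) := by
  have hy0 := hy.ne_zero
  have hsy0 : σ y ≠ 0 := by simpa using hy0
  have : σ x * y ^ (-i) = (σ y / y) ^ i * σ (x * y ^ (-i)) := by
    rw [map_mul, map_zpow₀, div_zpow, zpow_neg, zpow_neg]
    field_simp
  rw [DegLT, this]
  exact ((residue_map_div hy hA).zpow hy hA.mul_ne i).mul_properFrac (ProperFrac.map hM hy hA h)

theorem degLT_map_zpow (hy : TransOver M y) (hA : Affine σ M y α a) (i : ℤ) :
    DegLT M y i (σ y ^ i - α ^ i * y ^ i) := by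
  have hy0 := hy.ne_zero
  have : (σ y ^ i - α ^ i * y ^ i) * y ^ (-i) = (σ y / y) ^ i - α ^ i := by
    rw [div_zpow, zpow_neg]
    field_simp
  rw [DegLT, this]
  exact ((residue_map_div hy hA).zpow hy hA.mul_ne i).2

/-- The operator `x ↦ βσ(x) - x` respects the degree filtration and acts on the coefficient of `y^i`
by `w ↦ βα^i σ(w) - w`. The coefficient comparisons below rest on this. -/
theorem DegLT.lead_step (hM : Stable σ M) (hy : TransOver M y) (hA : Affine σ M y α a)
    (hβ : β ∈ M) (h : DegLT M y (i + 1) x) :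
    ∃ w ∈ M, DegLT M y i (x - w * y ^ i) ∧
      DegLT M y i ((β * σ x - x) - (β * α ^ i * σ w - w) * y ^ i) := by
  obtain ⟨w, hw, hd⟩ := h.exists_lead hy
  refine ⟨w, hw, hd, ?_⟩
  have h1 := (hd.map hM hy hA).const_mul hβ
  have h2 := (degLT_map_zpow hy hA i).const_mul (mul_mem hβ ((hM w).2 hw))
  have : (β * σ x - x) - (β * α ^ i * σ w - w) * y ^ i =
      β * σ (x - w * y ^ i) + β * σ w * (σ y ^ i - α ^ i * y ^ i) - (x - w * y ^ i) := by
    simp only [map_sub, map_mul, map_zpow₀]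
    ring
  rw [this]
  exact (h1.add h2).sub hd

/-- A twisted telescoping equation over `M` has its solutions from `M(y)` in `M`. -/
theorem mem_of_twisted (hM : Stable σ M) (hy : TransOver M y) (hA : Affine σ M y α a)
    (hβ : β ∈ M) (hhom : ∀ i : ℤ, i ≠ 0 → ∀ w ∈ M, β * α ^ i * σ w = w → w = 0)
    (hx : x ∈ adj M {y}) (h : β * σ x - x ∈ M) : x ∈ M := by
  -- An element of `M` has no term `y^i` with `i > 0`, so the leading coefficient solves the
  -- homogeneous equation and vanishes.
  have pos : ∀ i : ℤ, 0 < i → DegLT M y (i + 1) x → DegLT M y i x := by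
    intro i hi hd
    obtain ⟨w, hw, h1, h2⟩ := hd.lead_step hM hy hA hβ
    have h3 := (DegLT.const hy h hi).sub h2
    rw [sub_sub_cancel] at h3
    have hc := h3.coeff_eq_zero hy
      (sub_mem (mul_mem (mul_mem hβ (zpow_mem hA.mul_mem _)) ((hM w).2 hw)) hw)
    have hw0 := hhom i hi.ne' w hw (sub_eq_zero.1 hc)
    simpa [hw0] using h1
  obtain ⟨n, hn⟩ := DegLT.exists_of_mem hy hx
  have h1 : DegLT M y (0 + 1) x := by
    have : ∀ m : ℕ, DegLT M y (m + 1) x → DegLT M y (0 + 1) x := by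
      intro m
      induction m with
      | zero => intro h; exact_mod_cast h
      | succ m ih =>
        intro h
        refine ih (pos _ (by positivity) ?_)
        exact_mod_cast h
    exact this n (hn.mono hy (by omega))
  obtain ⟨w, hw, h2⟩ := h1.exists_lead hy
  rw [zpow_zero, mul_one] at h2
  have hM' : β * σ (x - w) - (x - w) ∈ M := by
    have : β * σ (x - w) - (x - w) = (β * σ x - x) - (β * σ w - w) := by rw [map_sub]; ring
    rw [this]
    exact sub_mem h (sub_mem (mul_mem hβ ((hM w).2 hw)) hw)
  -- This element lies in `M` and has negative degree. Once it is known to vanish, the negative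
  -- coefficients solve homogeneous equations too.
  have h0 : β * σ (x - w) - (x - w) = 0 := by
    have := ((h2.map hM hy hA).const_mul hβ).sub h2
    exact DegLT.coeff_eq_zero (i := 0) hy hM' (by simpa using this)
  have hall : ∀ m : ℕ, DegLT M y (-m) (x - w) := by
    intro m
    induction m with
    | zero => simpa using h2
    | succ m ih =>
      have e : (-(m + 1 : ℕ) : ℤ) + 1 = -m := by push_cast; ring
      rw [← e] at ih
      obtain ⟨v, hv, h3, h4⟩ := ih.lead_step hM hy hA hβ
      rw [h0] at h4
      have h5 := DegLT.zero.sub h4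
      rw [zero_sub, zero_sub, neg_neg] at h5
      have hc := h5.coeff_eq_zero hy
        (sub_mem (mul_mem (mul_mem hβ (zpow_mem hA.mul_mem _)) ((hM v).2 hv)) hv)
      have hv0 := hhom _ (by omega) v hv (sub_eq_zero.1 hc)
      simpa [hv0] using h3
  have := eq_zero_of_forall_degLT hy (sub_mem hx (le_adj _ hw)) hall
  rw [sub_eq_zero.1 this]
  exact hw

/-- If `h ∈ K(y)` is the sum of an element of `M` and the difference of `g ∈ M(y)`, then `g`
lies in `K(y)` up to an element of `M`. -/
theorem exists_sub_mem_adj (hKM : K ≤ M) (hK : Stable σ K) (hM : Stable σ M)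
    (hy : TransOver M y) (hA : Affine σ K y α a)
    (hT : ∀ i : ℤ, i ≠ 0 → ∀ w ∈ M, α ^ i * σ w - w ∈ K → w ∈ K) {h g : E}
    (hh : h ∈ adj K {y}) (hg : g ∈ adj M {y}) (hb : h - (σ g - g) ∈ M) :
    ∃ m ∈ M, g - m ∈ adj K {y} := by
  have hA' := hA.mono hKM
  have hKs := hK.adj_singleton hA
  -- The coefficient of `y^i` in `h` is `α^i σ(w) - w`. It lies in `K` because `h ∈ K(y)`, hence so
  -- does `w` by `hT`. For `i > 0` an error from `M` is invisible; for `i < 0` the equation has to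
  -- be exact.
  have step : ∀ i : ℤ, i ≠ 0 → ∀ h ∈ adj K {y}, ∀ x, h - (σ x - x) ∈ M →
      (0 < i ∨ h = σ x - x) → DegLT M y (i + 1) x →
      ∃ k ∈ adj K {y}, DegLT M y i (x - k) := by
    intro i hi h hh x hb hi' hd
    obtain ⟨w, hw, h1, h2⟩ := hd.lead_step hM hy hA' (one_mem M)
    rw [one_mul, one_mul] at h2
    have hwM : α ^ i * σ w - w ∈ M :=
      sub_mem (mul_mem (zpow_mem hA'.mul_mem _) ((hM w).2 hw)) hw
    have h3 : DegLT M y i (h - (α ^ i * σ w - w) * y ^ i) := by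
      have hbd : DegLT M y i (h - (σ x - x)) := by
        rcases hi' with hi' | rfl
        · exact DegLT.const hy hb hi'
        · rw [sub_self]; exact .zero
      have := hbd.add h2
      rwa [sub_add_sub_cancel] at this
    have hwK := hT i hi w hw (coeff_mem hKM hy hh hwM h3)
    exact ⟨w * y ^ i, mul_mem (le_adj _ hwK) (zpow_mem mem_adj_self _), h1⟩
  have pos : ∀ m : ℕ, ∀ x h, h ∈ adj K {y} → h - (σ x - x) ∈ M → DegLT M y (m + 1) x →
      ∃ k ∈ adj K {y}, DegLT M y (0 + 1) (x - k) := by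
    intro m
    induction m with
    | zero => intro x h _ _ hd; exact ⟨0, zero_mem _, by simpa using hd⟩
    | succ m ih =>
      intro x h hh hb hd
      obtain ⟨k, hk, hd'⟩ := step (m + 1) (by omega) h hh x hb (Or.inl (by omega))
        (by exact_mod_cast hd)
      obtain ⟨k', hk', hd''⟩ := ih (x - k) (h - (σ k - k))
        (sub_mem hh (sub_mem ((hKs k).2 hk) hk))
        (by rw [map_sub]; convert hb using 1; ring) hd'
      exact ⟨k + k', add_mem hk hk', by rwa [← sub_sub]⟩
  obtain ⟨n, hn⟩ := DegLT.exists_of_mem hy hg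
  obtain ⟨k, hk, hd⟩ := pos n g h hh hb (hn.mono hy (by omega))
  obtain ⟨m, hm, hd⟩ := hd.exists_lead hy
  rw [zpow_zero, mul_one] at hd
  refine ⟨m, hm, ?_⟩
  set x := g - k - m with hx
  have hxM : x ∈ adj M {y} := sub_mem (sub_mem hg (adj_mono hKM le_rfl hk)) (le_adj _ hm)
  -- As `x` has negative degree, the error is the constant term of an element of `K(y)`. So it lies
  -- in `K` and can be absorbed into the right-hand side.
  obtain ⟨h', hh', hhx⟩ : ∃ h' ∈ adj K {y}, h' = σ x - x := by
    set h1 := h - (σ k - k) with hh1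
    have hh1K : h1 ∈ adj K {y} := sub_mem hh (sub_mem ((hKs k).2 hk) hk)
    have hbM : h1 - (σ x - x) ∈ M := by
      have : h1 - (σ x - x) = (h - (σ g - g)) + (σ m - m) := by
        rw [hh1, hx, map_sub, map_sub]; ring
      rw [this]
      exact add_mem hb (sub_mem ((hM m).2 hm) hm)
    have hbK : h1 - (σ x - x) ∈ K := by
      refine coeff_mem (i := 0) hKM hy hh1K hbM ?_
      rw [zpow_zero, mul_one, sub_sub_cancel]
      exact (hd.map hM hy hA').sub hd
    exact ⟨h1 - (h1 - (σ x - x)), sub_mem hh1K (le_adj _ hbK), by ring⟩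
  have hxK : x ∈ adj K {y} := by
    refine mem_adj_of_approx hKM hy hxM fun n => ?_
    induction n with
    | zero => exact ⟨0, zero_mem _, by simpa using hd⟩
    | succ n ih =>
      obtain ⟨k', hk', hd'⟩ := ih
      have e : (-(n + 1 : ℕ) : ℤ) + 1 = -n := by push_cast; ring
      rw [← e] at hd'
      have heq : h' - (σ k' - k') = σ (x - k') - (x - k') := by
        rw [hhx, map_sub σ x k']; ring
      obtain ⟨k'', hk'', hd''⟩ := step _ (by omega) (h' - (σ k' - k'))
        (sub_mem hh' (sub_mem ((hKs k').2 hk') hk')) (x - k') (by rw [heq, sub_self]; exact zero_mem _)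
        (Or.inr heq) hd'
      exact ⟨k' + k'', add_mem hk' hk'', by rwa [← sub_sub]⟩
  have : g - m = x + k := by rw [hx]; ring
  rw [this]
  exact add_mem hxK hk

/-- This isolates the second coefficient of `(y + a)^i`, namely `i a`, also for negative `i`. -/
theorem residue_zpow_sub_one (hy : TransOver M y) (hA : Affine σ M y 1 a) (i : ℤ) :
    Residue M y (y * ((σ y / y) ^ i - 1)) (i * a) := by
  have hy0 := hy.ne_zero
  have hu : Residue M y (σ y / y) 1 := residue_map_div hy hA
  have hyu : y * (σ y / y - 1) = a := by
    rw [hA.map_eq]; field_simp; ring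
  have hsy0 : σ y ≠ 0 := by simpa using hy0
  have hu0 : σ y / y ≠ 0 := div_ne_zero hsy0 hy0
  induction i using Int.induction_on with
  | zero => simpa using Residue.const (zero_mem M)
  | succ n ih =>
    have e : y * ((σ y / y) ^ (n + 1 : ℤ) - 1) = y * ((σ y / y) ^ (n : ℤ) - 1) * (σ y / y) + a := by
      rw [zpow_add_one₀ hu0, ← hyu]; ring
    rw [e]
    have := (ih.mul hu).add (Residue.const hA.add_mem)
    convert this using 1
    push_cast; ring
  | pred n ih =>
    have e : y * ((σ y / y) ^ (-n - 1 : ℤ) - 1) =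
        (y * ((σ y / y) ^ (-n : ℤ) - 1) - a) * (σ y / y)⁻¹ := by
      rw [zpow_sub_one₀ hu0, ← hyu, ← mul_sub, sub_sub_sub_cancel_right, mul_assoc, sub_mul,
        mul_inv_cancel₀ hu0]
    rw [e]
    have := (ih.sub (Residue.const hA.add_mem)).mul (hu.inv hy one_ne_zero)
    convert this using 1
    push_cast; ring

/-- A telescoping equation over `M` with a solution `x` in a `Σ`-extension `M(y)`. -/
theorem exists_sub_mul_mem [CharZero E] (hM : Stable σ M) (hC : ∀ c, σ c = c → c ∈ M)
    (hy : TransOver M y) (hA : Affine σ M y 1 a) (hx : x ∈ adj M {y}) (h : σ x - x ∈ M) :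
    ∃ c, σ c = c ∧ x - c * y ∈ M := by
  have hy0 := hy.ne_zero
  have lead : ∀ i : ℤ, i ≠ 0 → ∀ x, σ x - x ∈ M → DegLT M y (i + 1) x →
      ∃ w ∈ M, DegLT M y i (x - w * y ^ i) ∧ σ w = w ∧ (i < 0 → σ x - x = 0) := by
    intro i hi x h hd
    obtain ⟨w, hw, h1, h2⟩ := hd.lead_step hM hy hA (one_mem M)
    rw [one_mul, one_zpow, one_mul, one_mul] at h2
    have hneg : i < 0 → σ x - x = 0 := by
      intro hi
      have := (hd.map hM hy hA).sub hd
      exact DegLT.coeff_eq_zero (i := 0) hy h (by simpa using this.mono hy (by omega))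
    have hb : DegLT M y i (σ x - x) := by
      rcases hi.lt_or_gt with hi | hi
      · rw [hneg hi]; exact .zero
      · exact DegLT.const hy h hi
    have h3 := hb.sub h2
    rw [sub_sub_cancel] at h3
    exact ⟨w, hw, h1, sub_eq_zero.1 (h3.coeff_eq_zero hy (sub_mem ((hM w).2 hw) hw)), hneg⟩
  -- The leading coefficient `w` is a constant, and the next one satisfies `σ(w') - w' + i a w = 0`.
  -- If `w ≠ 0`, then `y + w'/(iw)` is a constant, hence in `M`, against transcendence. The exponent
  -- `1` is exempt because there the next coefficient meets the right-hand side in `M`.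
  have step : ∀ i : ℤ, i ≠ 0 → i ≠ 1 → ∀ x, σ x - x ∈ M → DegLT M y (i + 1) x →
      DegLT M y i x := by
    intro i hi hi1 x h hd
    obtain ⟨w, hw, h1, hσw, hneg⟩ := lead i hi x h hd
    have h1' : DegLT M y (i - 1 + 1) (x - w * y ^ i) := by simpa using h1
    obtain ⟨w', hw', h2⟩ := h1'.exists_lead hy
    have h3 := (h2.map hM hy hA).sub h2
    have h4 : DegLT M y (i - 1) (w * (σ y ^ i - y ^ i) - i * a * w * y ^ (i - 1)) := by
      have e : (w * (σ y ^ i - y ^ i) - i * a * w * y ^ (i - 1)) * y ^ (-(i - 1)) =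
          w * (y * ((σ y / y) ^ i - 1) - i * a) := by
        rw [zpow_neg, zpow_sub_one₀ hy0, div_zpow]
        field_simp
      rw [DegLT, e]
      exact (residue_zpow_sub_one hy hA i).2.const_mul hw
    have h5 := (degLT_map_zpow hy hA (i - 1)).const_mul ((hM w').2 hw')
    rw [one_zpow, one_mul] at h5
    have hb : DegLT M y (i - 1) (σ x - x) := by
      rcases lt_or_ge i 0 with hi' | hi'
      · rw [hneg hi']; exact .zero
      · exact DegLT.const hy h (by omega)
    have h6 := ((hb.sub h3).sub h4).sub h5
    have e : σ x - x - (σ (x - w * y ^ i - w' * y ^ (i - 1)) - (x - w * y ^ i - w' * y ^ (i - 1))) -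
        (w * (σ y ^ i - y ^ i) - i * a * w * y ^ (i - 1)) - σ w' * (σ y ^ (i - 1) - y ^ (i - 1)) =
        (σ w' - w' + i * a * w) * y ^ (i - 1) := by
      simp only [map_sub, map_mul, map_zpow₀, hσw]
      ring
    rw [e] at h6
    have hia : (i : E) * a * w ∈ M := mul_mem (mul_mem (intCast_mem M i) hA.add_mem) hw
    have h7 := h6.coeff_eq_zero hy (add_mem (sub_mem ((hM w').2 hw') hw') hia)
    by_contra hcon
    have hw0 : w ≠ 0 := by
      rintro rfl
      simp only [zero_mul, sub_zero] at h1
      exact hcon h1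
    have hi0 : (i : E) ≠ 0 := by exact_mod_cast hi
    have hconst : σ (y + w' / (i * w)) = y + w' / (i * w) := by
      rw [map_add, hA.map_eq, map_div₀, map_mul, map_intCast, hσw]
      field_simp
      linear_combination h7
    have hmem := hC _ hconst
    have : w' / (i * w) ∈ M := div_mem hw' (mul_mem (intCast_mem M i) hw)
    exact hy.notMem ((add_mem_cancel_right this).1 hmem)
  obtain ⟨n, hn⟩ := DegLT.exists_of_mem hy hx
  have h1 : DegLT M y (1 + 1) x := by
    have : ∀ m : ℕ, DegLT M y (m + 2) x → DegLT M y (1 + 1) x := by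
      intro m
      induction m with
      | zero => intro h; simpa using h
      | succ m ih =>
        intro hd
        refine ih (step _ (by omega) (by omega) x h ?_)
        convert hd using 1
        push_cast; ring
    exact this n (hn.mono hy (by omega))
  obtain ⟨c, hc, h2, hσc, -⟩ := lead 1 one_ne_zero x h h1
  rw [zpow_one] at h2
  refine ⟨c, hσc, ?_⟩
  obtain ⟨w, hw, h3⟩ := DegLT.exists_lead (i := 0) hy (by simpa using h2)
  rw [zpow_zero, mul_one] at h3
  have h4 : σ (x - c * y - w) - (x - c * y - w) ∈ M := by
    have : σ (x - c * y - w) - (x - c * y - w) = (σ x - x) - c * a - (σ w - w) := by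
      simp only [map_sub, map_mul, hσc, hA.map_eq]; ring
    rw [this]
    exact sub_mem (sub_mem h (mul_mem hc hA.add_mem)) (sub_mem ((hM w).2 hw) hw)
  have hall : ∀ m : ℕ, DegLT M y (-m) (x - c * y - w) := by
    intro m
    induction m with
    | zero => simpa using h3
    | succ m ih =>
      refine step _ (by omega) (by omega) _ h4 ?_
      convert ih using 1
      push_cast; ring
  have := eq_zero_of_forall_degLT hy (sub_mem (sub_mem hx (mul_mem (le_adj _ hc) mem_adj_self))
    (le_adj _ hw)) hall
  rw [sub_eq_zero.1 this]
  exact hw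

end Automorphism

/-! ### Towers, and pairs of fields in which telescoping is controlled. -/

section Extensions

open Polynomial

variable {E : Type*} [Field E] {K M K' M' H : Subfield E} {σ : E ≃+* E} {y x u α a β : E} {i : ℤ}

theorem transOver_closure_iff {G : Type*} [Field G] [Algebra G E] {S : Set E} :
    TransOver (Subfield.closure (Set.range (algebraMap G E) ∪ S)) y ↔
      Transcendental (Algebra.adjoin G S) y := by
  rw [← IntermediateField.transcendental_adjoin_iff, transOver_iff]
  rfl

theorem transOver_adj_iff {S : Set E} :
    TransOver (adj K S) y ↔ Transcendental (Algebra.adjoin K S) y := by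
  rw [← transOver_closure_iff, adj]
  have : Set.range (algebraMap K E) = (K : Set E) := Subtype.range_coe
  rw [this]

/-- Algebraic independence of `u` and `y` is symmetric. This lets `Tow.adj_singleton` move a new
element below an existing tower. -/
theorem TransOver.swap (hu : TransOver M u) (hy : TransOver (adj M {u}) y) :
    TransOver (adj M {y}) u := by
  rw [transOver_adj_iff] at hy ⊢
  have h1 : AlgebraicIndependent M (fun _ : Unit => u) :=
    algebraicIndependent_unique_type_iff.2 (transOver_iff.1 hu)
  have h2 := (h1.option_iff_transcendental y).2 (by rwa [Set.range_const])
  have h3 := h2.transcendental_adjoin (s := {none}) (i := some ()) (by simp)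
  rwa [Set.image_singleton] at h3

theorem TransOver.zpow_notMem (h : TransOver M y) (hi : i ≠ 0) : y ^ i ∉ M := by
  have hn : ∀ n : ℕ, n ≠ 0 → y ^ n ∉ M := fun n hn hm =>
    X_pow_sub_C_ne_zero (Nat.pos_of_ne_zero hn) (y ^ n)
      (h _ (sub_mem (pow_mem X_mem_polyIn _) (C_mem_polyIn hm)) (by simp))
  obtain ⟨n, rfl | rfl⟩ := i.eq_nat_or_neg
  · rw [zpow_natCast]; exact hn n (by simpa using hi)
  · rw [zpow_neg, zpow_natCast, inv_mem_iff]; exact hn n (by simpa using hi)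

/-- Otherwise `w y^i` is a constant, hence in `M`, and so is `y^i`, which contradicts transcendence.
-/
theorem eq_zero_of_pi (hy : TransOver M y) (hA : Affine σ M y α 0)
    (hC : ∀ c, σ c = c → c ∈ M) (hi : i ≠ 0) {w : E} (hw : w ∈ M) (h : α ^ i * σ w = w) :
    w = 0 := by
  by_contra hw0
  have : σ (w * y ^ i) = w * y ^ i := by
    rw [map_mul, map_zpow₀, hA.map_eq, add_zero, mul_zpow, ← mul_assoc, mul_comm (σ w), h]
  have h2 := div_mem (hC _ this) hw
  rw [mul_div_cancel_left₀ _ hw0] at h2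
  exact hy.zpow_notMem hi h2

/-- If `σ y - y ∈ H` then `y` lies in `H` or is transcendental over `H`. -/
theorem mem_of_not_transOver [CharZero E] (hH : Stable σ H) (hC : ∀ c, σ c = c → c ∈ H)
    (hA : Affine σ H y 1 a) (hy : ¬ TransOver H y) : y ∈ H := by
  rw [transOver_iff, Transcendental, not_not] at hy
  have hint : IsIntegral H y := hy.isIntegral
  set p0 := minpoly H y with hp0
  have hmon : p0.Monic := minpoly.monic hint
  set n := p0.natDegree with hn
  have hn0 : 0 < n := minpoly.natDegree_pos hint
  set p := p0.map H.subtype with hp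
  have hpmon : p.Monic := hmon.map _
  have hpn : p.natDegree = n := hmon.natDegree_map _
  have hpH : p ∈ polyIn H := ⟨p0, rfl⟩
  have hp1 : p.map (σ : E →+* E) ∈ polyIn H := mem_polyIn.2 fun n => by
    rw [coeff_map]; exact (hH _).2 (mem_polyIn.1 hpH n)
  have hp1mon : (p.map (σ : E →+* E)).Monic := hpmon.map _
  have hp1n : (p.map (σ : E →+* E)).natDegree = n := by rw [hpmon.natDegree_map, hpn]
  have hp2 : taylor a (p.map (σ : E →+* E)) ∈ polyIn H := by
    rw [taylor_apply]
    exact comp_mem_polyIn hp1 (add_mem X_mem_polyIn (C_mem_polyIn hA.add_mem))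
  have hp2mon : (taylor a (p.map (σ : E →+* E))).Monic := by
    rw [taylor_apply]; exact hp1mon.comp_X_add_C a
  have hp2n : (taylor a (p.map (σ : E →+* E))).natDegree = n := by rw [natDegree_taylor, hp1n]
  have hev : eval y p = 0 := by
    rw [hp, eval_map]; exact minpoly.aeval H y
  have hev2 : eval y (taylor a (p.map (σ : E →+* E))) = 0 := by
    have : eval₂ (σ : E →+* E) ((σ : E →+* E) y) p = (σ : E →+* E) (eval y p) := eval₂_hom _ _
    rw [taylor_eval, eval_map]
    have hσ : y + a = (σ : E →+* E) y := by
      change _ = σ y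
      rw [hA.map_eq]; ring
    rw [hσ, this, hev, map_zero]
  -- If `p` is the minimal polynomial, applying `σ` to its coefficients and shifting by `a` gives a
  -- monic polynomial of the same degree that also vanishes at `y`. Minimality forces equality.
  have heq : taylor a (p.map (σ : E →+* E)) = p := by
    by_contra hne
    obtain ⟨r, hr⟩ := sub_mem hp2 hpH
    rw [coe_mapRingHom] at hr
    have hr0 : r ≠ 0 := by
      rintro rfl
      rw [Polynomial.map_zero] at hr
      exact hne (sub_eq_zero.1 hr.symm)
    have hd := minpoly.degree_le_of_ne_zero H y hr0 (by
      have : eval y (r.map H.subtype) = 0 := by rw [hr, eval_sub, hev, hev2, sub_zero]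
      rw [eval_map] at this; exact this)
    have hd2 : (r.map H.subtype).degree < p.degree := by
      rw [hr]
      have h1 : (taylor a (p.map (σ : E →+* E))).degree = p.degree := by
        rw [degree_eq_natDegree hp2mon.ne_zero, degree_eq_natDegree hpmon.ne_zero, hp2n, hpn]
      rw [← h1]
      exact degree_sub_lt_left h1 hp2mon.ne_zero (by rw [hp2mon.leadingCoeff, hpmon.leadingCoeff])
    rw [degree_map, hp, degree_map] at hd2
    exact absurd hd2 (not_lt.2 hd)
  -- In degree `n - 1`, where `p` has coefficient `c`, this reads `n a + σ(c) = c`. Hence `y + c/n`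
  -- is a constant; the division by `n` needs characteristic zero.
  have hco := congrArg (fun q => q.coeff (n - 1)) heq
  simp only [taylor_coeff] at hco
  have hle : (hasseDeriv (n - 1) (p.map (σ : E →+* E))).natDegree ≤ 1 := by
    refine (natDegree_hasseDeriv_le _ _).trans ?_
    rw [hp1n]; omega
  rw [eq_X_add_C_of_natDegree_le_one hle, hasseDeriv_coeff, hasseDeriv_coeff] at hco
  have e1 : 1 + (n - 1) = n := by omega
  have hlead : (p.map (σ : E →+* E)).coeff n = 1 := by
    rw [← hp1n]; exact hp1mon
  have hch : n.choose (n - 1) = n := by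
    rw [Nat.choose_symm_of_eq_add (show n = (n - 1) + 1 by omega), Nat.choose_one_right]
  rw [e1, hlead, hch, zero_add, Nat.choose_self, coeff_map] at hco
  simp only [eval_add, eval_mul, eval_C, eval_X, mul_one, Nat.cast_one, one_mul] at hco
  change n * a + σ (p.coeff (n - 1)) = _ at hco
  have hcH : p.coeff (n - 1) ∈ H := mem_polyIn.1 hpH _
  have hnE : (n : E) ≠ 0 := by exact_mod_cast hn0.ne'
  have hconst : σ (y + p.coeff (n - 1) / n) = y + p.coeff (n - 1) / n := by
    rw [map_add, hA.map_eq, map_div₀, map_natCast]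
    field_simp
    linear_combination hco
  exact (add_mem_cancel_right (div_mem hcH (natCast_mem H n))).1 (hC _ hconst)

/-- `M` arises from `K` by a finite number of transcendental `Σ`- and `Π`-type adjunctions. -/
inductive Tow (σ : E ≃+* E) (K : Subfield E) : Subfield E → Prop
  | refl : Tow σ K K
  | step {M : Subfield E} {u α a : E} : Tow σ K M → Affine σ M u α a → (α = 1 ∨ a = 0) →
      TransOver M u → Tow σ K (adj M {u})

theorem Tow.le (h : Tow σ K M) : K ≤ M := by
  induction h with
  | refl => exact le_rfl
  | step _ _ _ _ ih => exact ih.trans (le_adj _)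

theorem Tow.stable (h : Tow σ K M) (hK : Stable σ K) : Stable σ M := by
  induction h with
  | refl => exact hK
  | step _ hA _ _ ih => exact ih.adj_singleton hA

theorem Tow.adj_singleton (h : Tow σ K M) (hy : TransOver M y) :
    Tow σ (adj K {y}) (adj M {y}) := by
  induction h with
  | refl => exact .refl
  | @step M u α a _ hA ht hu ih =>
    rw [adj_adj, Set.union_comm, ← adj_adj]
    exact (ih (hy.mono (le_adj _))).step (hA.mono (le_adj _)) ht (hu.swap hy)

/-- The tower is descended step by step with the one-variable result. At a `Π`-step, a nonzero
solution `w` of the equation twisted by `α^i` would yield the solution `w u^i` of the original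
homogeneous equation, which `hhom` excludes. -/
theorem Tow.mem_of_twisted (h : Tow σ K M) (hK : Stable σ K) (hβ : β ∈ K)
    (hhom : ∀ w ∈ M, β * σ w = w → w = 0) (hx : x ∈ M) (hx' : β * σ x - x ∈ K) : x ∈ K := by
  induction h with
  | refl => exact hx
  | @step M u α a hT hA ht hu ih =>
    refine ih (fun w hw => hhom w (le_adj _ hw)) ?_
    refine _root_.mem_of_twisted (hT.stable hK) hu hA (hT.le hβ) ?_ hx (hT.le hx')
    intro i hi w hw h
    rcases ht with rfl | rfl
    · rw [one_zpow, mul_one] at h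
      exact hhom w (le_adj _ hw) h
    · have : w * u ^ i = 0 := by
        refine hhom _ (mul_mem (le_adj _ hw) (zpow_mem mem_adj_self _)) ?_
        rw [map_mul, map_zpow₀, hA.map_eq, add_zero, mul_zpow]
        linear_combination u ^ i * h
      exact (mul_eq_zero.1 this).resolve_right (zpow_ne_zero _ hu.ne_zero)

/-- The solutions in `M` of telescoping equations over `K` lie in `K`. -/
def TeleClosed (σ : E ≃+* E) (K M : Subfield E) : Prop := ∀ g ∈ M, σ g - g ∈ K → g ∈ K

/-- The pair `K' ≤ M'` is an extension of the pair `K ≤ M` in which telescoping equations are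
controlled. -/
structure PairExt (σ : E ≃+* E) (K M K' M' : Subfield E) : Prop where
  le_left : K ≤ K'
  le_right : M ≤ M'
  stable : Stable σ K'
  tow : Tow σ K' M'
  tele : ∀ h ∈ K', ∀ g ∈ M', h - (σ g - g) ∈ M → ∃ m ∈ M, g - m ∈ K'
  inter : ∀ x ∈ K', x ∈ M → x ∈ K

theorem PairExt.refl (hK : Stable σ K) (hT : Tow σ K M) : PairExt σ K M K M :=
  ⟨le_rfl, le_rfl, hK, hT, fun _ _ g hg _ => ⟨g, hg, by simp⟩, fun _ hx _ => hx⟩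

/-- Split `g` into `m ∈ M` and a part in `K'`. The difference of `m` lies in `K' ∩ M = K`, so `m ∈
K`. -/
theorem PairExt.closed (h : PairExt σ K M K' M') (hM : Stable σ M) (hc : TeleClosed σ K M) :
    TeleClosed σ K' M' := by
  intro g hg hh
  obtain ⟨m, hm, hgm⟩ := h.tele _ hh g hg (by rw [sub_self]; exact zero_mem _)
  have h1 : σ m - m ∈ K' := by
    have : σ m - m = (σ g - g) - (σ (g - m) - (g - m)) := by rw [map_sub]; ring
    rw [this]
    exact sub_mem hh (sub_mem ((h.stable _).2 hgm) hgm)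
  have h2 := hc m hm (h.inter _ h1 (sub_mem ((hM m).2 hm) hm))
  have := add_mem hgm (h.le_left h2)
  rwa [sub_add_cancel] at this

theorem mem_of_mem_adj (hKM : K ≤ M) (hy : TransOver M y) (hx : x ∈ adj K {y}) (hxM : x ∈ M) :
    x ∈ K := by
  refine coeff_mem (i := 0) hKM hy hx hxM ?_
  rw [zpow_zero, mul_one, sub_self]
  exact .zero

/-- Coefficient comparison reduces `g` to a remainder `m ∈ M'`. The equation left for `m` has its
right-hand side in `K'(y) ∩ M' = K'` and the same error in `M`, so `tele` of the old pair applies.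
-/
theorem PairExt.adjoin (h : PairExt σ K M K' M') (hA : Affine σ K' y α a)
    (hy : TransOver M' y)
    (hT : ∀ i : ℤ, i ≠ 0 → ∀ w ∈ M', α ^ i * σ w - w ∈ K' → w ∈ K') :
    PairExt σ K M (adj K' {y}) (adj M' {y}) := by
  have hKM := h.tow.le
  have hsM := h.tow.stable h.stable
  have hs := h.stable.adj_singleton hA
  refine ⟨h.le_left.trans (le_adj _), h.le_right.trans (le_adj _), hs,
    h.tow.adj_singleton hy, ?_, ?_⟩
  · intro b hb g hg hbg
    obtain ⟨m, hm, hgm⟩ := exists_sub_mem_adj hKM h.stable hsM hy hA hT hb hg (h.le_right hbg)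
    have e : b - (σ (g - m) - (g - m)) = b - (σ g - g) + (σ m - m) := by rw [map_sub]; ring
    have h1 : b - (σ (g - m) - (g - m)) ∈ K' := by
      refine mem_of_mem_adj hKM hy (sub_mem hb (sub_mem ((hs _).2 hgm) hgm)) ?_
      rw [e]
      exact add_mem (h.le_right hbg) (sub_mem ((hsM m).2 hm) hm)
    obtain ⟨m1, hm1, hmm⟩ := h.tele _ h1 m hm (by rw [e, add_sub_cancel_right]; exact hbg)
    refine ⟨m1, hm1, ?_⟩
    have := add_mem hgm (le_adj {y} hmm)
    rwa [sub_add_sub_cancel] at this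
  · intro x hx hxM
    exact h.inter x (mem_of_mem_adj hKM hy hx (h.le_right hxM)) hxM

/-- No transcendence is needed: if `y` is algebraic over `M'`, it lies in `M'`, then in `K'` by
closure, and nothing changes. -/
theorem PairExt.adjoin_sigma [CharZero E] (h : PairExt σ K M K' M') (hM : Stable σ M)
    (hc : TeleClosed σ K M) (hC : ∀ c, σ c = c → c ∈ K') (hA : Affine σ K' y 1 a) :
    PairExt σ K M (adj K' {y}) (adj M' {y}) := by
  have hcl := h.closed hM hc
  by_cases hy : TransOver M' y
  · refine h.adjoin hA hy fun i _ w hw hwK => hcl w hw ?_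
    rwa [one_zpow, one_mul] at hwK
  · have hyM := mem_of_not_transOver (h.tow.stable h.stable) (fun c hc => h.tow.le (hC c hc))
      (hA.mono h.tow.le) hy
    have hyK : y ∈ K' := hcl y hyM (by
      rw [hA.map_eq, one_mul, add_sub_cancel_left]; exact hA.add_mem)
    rw [adj_eq_self (Set.singleton_subset_iff.2 hyK), adj_eq_self (Set.singleton_subset_iff.2 hyM)]
    exact h

/-- The condition on coefficients is a twisted equation in the tower `M'` over `K'`. Its homogeneous
version has only the zero solution, for otherwise a new constant arises. -/
theorem PairExt.adjoin_pi (h : PairExt σ K M K' M') (hC : ∀ c, σ c = c → c ∈ K')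
    (hA : Affine σ K' y α 0) (hy : TransOver M' y) :
    PairExt σ K M (adj K' {y}) (adj M' {y}) := by
  refine h.adjoin hA hy fun i hi w hw hwK => ?_
  refine h.tow.mem_of_twisted h.stable (zpow_mem hA.mul_mem i) ?_ hw hwK
  intro w hw hw'
  exact eq_zero_of_pi hy (hA.mono h.tow.le) (fun c hc => h.tow.le (hC c hc)) hi hw hw'

end Extensions

/-! ### Linear algebra over the field of constants. -/

section Fixed

variable {E : Type*} [Field E]

/-- The field of constants. -/
def constField (σ : E ≃+* E) : Subfield E := (σ : E →+* E).eqLocusField (RingHom.id E)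

theorem mem_constField {σ : E ≃+* E} {c : E} : c ∈ constField σ ↔ σ c = c := Iff.rfl

/-- Modulo `M`, the space `W` lies in the image of the finitely generated `U`; generators of its
image lift to `W`. -/
theorem Submodule.exists_finset_span_sub_mem {k V : Type*} [Field k] [AddCommGroup V] [Module k V]
    {W M U : Submodule k V} (hU : U.FG) (h : ∀ w ∈ W, ∃ u ∈ U, w - u ∈ M) :
    ∃ Y : Finset V, (Y : Set V) ⊆ W ∧ ∀ w ∈ W, ∃ v ∈ Submodule.span k (Y : Set V), w - v ∈ M := by
  classical
  have hfg : (U.map M.mkQ).FG := hU.map _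
  have hle : W.map M.mkQ ≤ U.map M.mkQ := by
    rintro _ ⟨w, hw, rfl⟩
    obtain ⟨u, hu, huw⟩ := h w hw
    exact ⟨u, hu, ((Submodule.Quotient.eq M).2 huw).symm⟩
  have := Module.Finite.iff_fg.2 hfg
  have hWfg : (W.map M.mkQ).FG := Submodule.FG.of_le hfg hle
  obtain ⟨s, hs⟩ := hWfg
  have hsub : (s : Set _) ⊆ M.mkQ '' (W : Set V) := by
    rw [← Submodule.map_coe, ← hs]; exact Submodule.subset_span
  obtain ⟨Y, hYW, rfl⟩ := Finset.subset_set_image_iff.1 hsub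
  refine ⟨Y, hYW, fun w hw => ?_⟩
  have : M.mkQ w ∈ (Submodule.span k (Y : Set V)).map M.mkQ := by
    rw [Submodule.map_span, ← Finset.coe_image, hs]; exact ⟨w, hw, rfl⟩
  obtain ⟨v, hv, hvw⟩ := this
  exact ⟨v, hv, by rw [← Submodule.ker_mkQ M, LinearMap.mem_ker, map_sub, hvw, sub_self]⟩

end Fixed

/-! ### Graded towers and the adjunction of solutions at one level. -/

section Core

variable {E : Type*} [Field E] {σ : E ≃+* E} {K M H K' M' : Subfield E} {N : ℕ}

/-- A tower of transcendental `Σ`- and `Π`-type adjunctions `z` over `B`, graded by `D`, in which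
no new constants arise. -/
structure GradedTower (σ : E ≃+* E) (B : Subfield E) (z : Fin N → E) (D : Fin N → ℕ) : Prop where
  stable : Stable σ B
  const : ∀ c, σ c = c → c ∈ B
  trans : ∀ (S : Set (Fin N)) (j : Fin N), j ∉ S → TransOver (adj B (z '' S)) (z j)
  step : ∀ i, ∃ α a, Affine σ (adj B (z '' {l | l < i ∧ D l < D i})) (z i) α a ∧ (α = 1 ∨ a = 0)
  pos : ∀ i, 1 ≤ D i

variable {B : Subfield E} {z : Fin N → E} {D : Fin N → ℕ}

theorem adj_image_insert (K : Subfield E) (z : Fin N → E) (S : Set (Fin N)) (i : Fin N) :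
    adj K (z '' insert i S) = adj (adj K (z '' S)) {z i} := by
  rw [adj_adj, Set.image_insert_eq, Set.union_singleton]

theorem adj_image_le {S : Set (Fin N)} (hB : B ≤ K) (h : ∀ i ∈ S, z i ∈ K) :
    adj B (z '' S) ≤ K :=
  adj_le hB (by rintro _ ⟨i, hi, rfl⟩; exact h i hi)

theorem gen_mem_adj {S : Set (Fin N)} {i : Fin N} (h : i ∈ S) : z i ∈ adj B (z '' S) :=
  mem_adj_of_mem ⟨i, h, rfl⟩

theorem adj_image_mono {S T : Set (Fin N)} (h : S ⊆ T) : adj B (z '' S) ≤ adj B (z '' T) :=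
  adj_mono le_rfl (Set.image_mono h)

theorem GradedTower.stable_adj (hz : GradedTower σ B z D) {S : Set (Fin N)}
    (hS : ∀ i ∈ S, ∀ l, l < i → D l < D i → l ∈ S) : Stable σ (adj B (z '' S)) := by
  refine hz.stable.adj_set ?_ ?_
  all_goals
    rintro _ ⟨i, hi, rfl⟩
    obtain ⟨α, a, hA, -⟩ := hz.step i
    have hle : adj B (z '' {l | l < i ∧ D l < D i}) ≤ adj B (z '' S) :=
      adj_image_mono fun l hl => hS i hi l hl.1 hl.2
  · rw [hA.map_eq]
    exact add_mem (mul_mem (hle hA.mul_mem) (gen_mem_adj hi)) (hle hA.add_mem)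
  -- The preimage of `z i` under `σ` involves preimages of the coefficients, so the fields of
  -- coefficients must be known to be stable first; this goes by induction on the index.
  · have hst : ∀ i : Fin N, Stable σ (adj B (z '' {l | l < i ∧ D l < D i})) := by
      intro i
      induction i using WellFoundedLT.induction with
      | _ i ih =>
        refine hz.stable.adj_set ?_ ?_
        all_goals
          rintro _ ⟨j, hj, rfl⟩
          obtain ⟨α, a, hA, -⟩ := hz.step j
          have hle : adj B (z '' {l | l < j ∧ D l < D j}) ≤ adj B (z '' {l | l < i ∧ D l < D i}) :=
            adj_image_mono fun l hl => ⟨hl.1.trans hj.1, hl.2.trans hj.2⟩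
        · rw [hA.map_eq]
          exact add_mem (mul_mem (hle hA.mul_mem) (gen_mem_adj hj)) (hle hA.add_mem)
        · rw [hA.symm_eq]
          exact div_mem (sub_mem (gen_mem_adj hj) (hle ((ih j hj.1).symm_mem hA.add_mem)))
            (hle ((ih j hj.1).symm_mem hA.mul_mem))
    rw [hA.symm_eq]
    exact div_mem (sub_mem (gen_mem_adj hi) (hle ((hst i).symm_mem hA.add_mem)))
      (hle ((hst i).symm_mem hA.mul_mem))

/-- All equations have coefficients in the same `H`, so the order of adjunction is irrelevant. A
`Σ`-type element contributes a constant multiple of itself to a telescoping solution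
(`exists_sub_mul_mem`), a `Π`-type element nothing (`mem_of_twisted`). An algebraic `Σ`-type element
is already present; for `Π`-type elements transcendence has to come from `htr`, hence the
requirement that `H` avoids `z i`. -/
theorem stable_and_tow_adj_finset [CharZero E] (hH : Stable σ H) (hC : ∀ c, σ c = c → c ∈ H)
    (htr : ∀ (S : Set (Fin N)) (j : Fin N), j ∉ S → TransOver (adj B (z '' S)) (z j))
    (Sg : Set (Fin N)) (S : Finset (Fin N))
    (hS : ∀ i ∈ S, z i ∈ H ∨ (i ∈ Sg ∧ ∃ a, Affine σ H (z i) 1 a) ∨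
      ((∃ α, Affine σ H (z i) α 0) ∧ H ≤ adj B (z '' {i}ᶜ))) :
    Stable σ (adj H (z '' S)) ∧ (∀ K, Tow σ K H → Tow σ K (adj H (z '' S))) ∧
      ∀ x ∈ adj H (z '' S), σ x - x ∈ H →
        ∃ v ∈ Submodule.span (constField σ) (z '' (S ∩ Sg)), x - v ∈ H := by
  classical
  induction S using Finset.induction_on with
  | empty =>
    have : adj H (z '' ((∅ : Finset (Fin N)) : Set (Fin N))) = H := by
      rw [Finset.coe_empty, Set.image_empty, adj_eq_self (Set.empty_subset _)]
    rw [this]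
    exact ⟨hH, fun _ h => h, fun x hx _ => ⟨0, zero_mem _, by simpa using hx⟩⟩
  | insert i S hi ih =>
    obtain ⟨ih1, ih2, ih3⟩ := ih fun j hj => hS j (Finset.mem_insert_of_mem hj)
    have hmono : Submodule.span (constField σ) (z '' (S ∩ Sg)) ≤
        Submodule.span (constField σ) (z '' ((insert i S : Finset (Fin N)) ∩ Sg)) :=
      Submodule.span_mono (Set.image_mono (Set.inter_subset_inter_left _
        (by exact_mod_cast Finset.subset_insert i S)))
    have hC1 : ∀ c, σ c = c → c ∈ adj H (z '' S) := fun c hc => le_adj _ (hC c hc)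
    have skip : z i ∈ adj H (z '' S) → Stable σ (adj H (z '' (insert i S : Finset (Fin N)))) ∧
        (∀ K, Tow σ K H → Tow σ K (adj H (z '' (insert i S : Finset (Fin N))))) ∧
        ∀ x ∈ adj H (z '' (insert i S : Finset (Fin N))), σ x - x ∈ H →
        ∃ v ∈ Submodule.span (constField σ) (z '' ((insert i S : Finset (Fin N)) ∩ Sg)),
          x - v ∈ H := by
      intro h
      rw [Finset.coe_insert, adj_image_insert, adj_eq_self (Set.singleton_subset_iff.2 h)]
      refine ⟨ih1, ih2, fun x hx hx' => ?_⟩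
      obtain ⟨v, hv, h⟩ := ih3 x hx hx'
      exact ⟨v, by simpa using hmono hv, h⟩
    rcases hS i (Finset.mem_insert_self i S) with h | ⟨hiS, a, hA⟩ | ⟨⟨α, hA⟩, hle⟩
    · exact skip (le_adj _ h)
    · have hA1 := hA.mono (le_adj (z '' S))
      by_cases hy : TransOver (adj H (z '' S)) (z i)
      · rw [Finset.coe_insert, adj_image_insert]
        refine ⟨ih1.adj_singleton hA1, fun K hK => (ih2 K hK).step hA1 (Or.inl rfl) hy, ?_⟩
        intro x hx hx'
        obtain ⟨c, hc, hxc⟩ := exists_sub_mul_mem ih1 hC1 hy hA1 hx (le_adj _ hx')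
        have h1 : σ (x - c * z i) - (x - c * z i) ∈ H := by
          have : σ (x - c * z i) - (x - c * z i) = (σ x - x) - c * a := by
            rw [map_sub, map_mul, hc, hA.map_eq]; ring
          rw [this]
          exact sub_mem hx' (mul_mem (hC c hc) hA.add_mem)
        obtain ⟨v, hv, h2⟩ := ih3 _ hxc h1
        refine ⟨v + (⟨c, hc⟩ : constField σ) • z i, add_mem (by simpa using hmono hv)
          (Submodule.smul_mem _ _ (Submodule.subset_span ⟨i, ⟨Set.mem_insert _ _, hiS⟩, rfl⟩)), ?_⟩
        have : x - (v + (⟨c, hc⟩ : constField σ) • z i) = x - c * z i - v := by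
          change x - (v + c * z i) = _
          ring
        rw [this]
        exact h2
      · exact skip (mem_of_not_transOver ih1 hC1 hA1 hy)
    · have hA1 := hA.mono (le_adj (z '' S))
      have hy : TransOver (adj H (z '' S)) (z i) := by
        refine (htr {i}ᶜ i (by simp)).mono (adj_le hle ?_)
        rintro _ ⟨j, hj, rfl⟩
        exact gen_mem_adj (by rintro rfl; exact hi hj)
      rw [Finset.coe_insert, adj_image_insert]
      refine ⟨ih1.adj_singleton hA1, fun K hK => (ih2 K hK).step hA1 (Or.inr rfl) hy, ?_⟩
      intro x hx hx'
      have hxS : x ∈ adj H (z '' S) := by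
        refine mem_of_twisted (β := 1) ih1 hy hA1 (one_mem _) ?_ hx
          (by rw [one_mul]; exact le_adj _ hx')
        intro k hk w hw hkw
        rw [one_mul] at hkw
        exact eq_zero_of_pi hy hA1 hC1 hk hw hkw
      obtain ⟨v, hv, h⟩ := ih3 x hxS hx'
      exact ⟨v, by simpa using hmono hv, h⟩

variable {m : ℕ}

/-- The subfield generated by those `z i`, `i < m`, and those `y j`, `j < q`, whose level is at
most `k`. -/
def levelField (B : Subfield E) (z : Fin N → E) (D : Fin N → ℕ) (m : ℕ) (y : ℕ → E) (e : ℕ → ℕ)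
    (q k : ℕ) : Subfield E :=
  adj B (z '' {i | (i : ℕ) < m ∧ D i ≤ k} ∪ y '' {j | j < q ∧ e j ≤ k})

/-- The `y j`, `j < q`, form a graded tower of `Σ`-adjunctions over the field generated by the
`z i`, `i < m`. -/
def IsSigmaTower (σ : E ≃+* E) (B : Subfield E) (z : Fin N → E) (D : Fin N → ℕ) (m : ℕ) (y : ℕ → E)
    (e : ℕ → ℕ) (q : ℕ) : Prop :=
  ∀ j < q, 1 ≤ e j ∧
    σ (y j) - y j ∈ adj B (z '' {i | (i : ℕ) < m ∧ D i < e j} ∪ y '' {l | l < j ∧ e l < e j}) ∧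
    y j ∉ adj B (z '' {i | (i : ℕ) < m} ∪ y '' {l | l < j})

theorem PairExt.adjoin_gen [CharZero E] (hz : GradedTower σ B z D) (hBK : B ≤ K')
    (h : PairExt σ K M K' M') (hM : Stable σ M) (hc : TeleClosed σ K M) {S : Set (Fin N)}
    (hS : M' ≤ adj B (z '' S)) {j : Fin N} (hj : j ∉ S)
    (hle : ∀ l, l < j → D l < D j → z l ∈ K') :
    PairExt σ K M (adj K' {z j}) (adj M' {z j}) := by
  obtain ⟨α, a, hA, rfl | rfl⟩ := hz.step j
  · exact h.adjoin_sigma hM hc (fun c hc => hBK (hz.const c hc))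
      (hA.mono (adj_image_le hBK fun l hl => hle l hl.1 hl.2))
  · exact h.adjoin_pi (fun c hc => hBK (hz.const c hc))
      (hA.mono (adj_image_le hBK fun l hl => hle l hl.1 hl.2)) ((hz.trans S j hj).mono hS)

/-- Generators deeper than `k` are transcendental over the field of depth at most `k` with earlier
generators adjoined, so they can be removed one at a time. Thus an element new at its own level is
new over all of `F`. -/
theorem GradedTower.mem_of_mem_adj (hz : GradedTower σ B z D) (hm : m ≤ N) {k : ℕ}
    (hKk : K ≤ adj B (z '' {i | D i ≤ k})) (hzK : ∀ i : Fin N, (i : ℕ) < m → D i ≤ k → z i ∈ K)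
    {v : E} (hv : v ∈ adj B (z '' {i | D i ≤ k})) (hvK : v ∈ adj K (z '' {i | (i : ℕ) < m})) :
    v ∈ K := by
  have key : ∀ j : ℕ, j ≤ m → v ∈ adj K (z '' {i | (i : ℕ) < j}) → v ∈ K := by
    intro j
    induction j with
    | zero =>
      intro _ h
      have : {i : Fin N | (i : ℕ) < 0} = ∅ := by ext; simp
      rwa [this, Set.image_empty, adj_eq_self (Set.empty_subset _)] at h
    | succ j ih =>
      intro hj h
      refine ih (by omega) ?_
      set i : Fin N := ⟨j, by omega⟩ with hi
      have hset : {l : Fin N | (l : ℕ) < j + 1} = insert i {l : Fin N | (l : ℕ) < j} := by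
        ext l
        simp only [Set.mem_ofPred_eq, Set.mem_insert_iff, hi, Fin.ext_iff]
        omega
      rw [hset, adj_image_insert] at h
      by_cases hDi : D i ≤ k
      · rwa [adj_eq_self (Set.singleton_subset_iff.2
          (le_adj _ (hzK i (by simp [hi]; omega) hDi)))] at h
      · exact _root_.mem_of_mem_adj
          (adj_image_le (hKk.trans (adj_image_mono fun l hl => Or.inr hl))
            fun l hl => gen_mem_adj (Or.inl hl))
          (hz.trans {l | l < i ∨ D l ≤ k} i (by simp; omega)) h
          (adj_image_mono (fun l hl => Or.inr hl) hv)
  exact key m le_rfl hvK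

theorem IsSigmaTower.update {y : ℕ → E} {e : ℕ → ℕ} {q k : ℕ} {v : E}
    (h : IsSigmaTower σ B z D m y e q)
    (hv : σ v - v ∈ levelField B z D m y e q k)
    (hvn : v ∉ adj B (z '' {i | (i : ℕ) < m} ∪ y '' {l | l < q})) :
    IsSigmaTower σ B z D m (Function.update y q v) (Function.update e q (k + 1)) (q + 1) := by
  have him : ∀ (S : Set ℕ), q ∉ S → Function.update y q v '' S = y '' S := fun S hS =>
    Set.image_congr fun l hl => Function.update_of_ne (by rintro rfl; exact hS hl) _ _
  have hlev : ∀ j ≤ q, ∀ b, {l | l < j ∧ Function.update e q (k + 1) l < b} =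
      {l | l < j ∧ e l < b} := by
    intro j hj b
    ext l
    refine and_congr_right fun hl => ?_
    rw [Function.update_of_ne (by omega)]
  intro j hj
  rcases Nat.lt_succ_iff_lt_or_eq.1 hj with hj | rfl
  · rw [Function.update_of_ne hj.ne, Function.update_of_ne hj.ne, hlev j hj.le,
      him _ (fun hq => by have := hq.1; omega), him _ (fun hq => by simp at hq; omega)]
    exact h j hj
  · rw [Function.update_self, Function.update_self, hlev j le_rfl,
      him _ (fun hq => by have := hq.1; omega), him _ (fun hq => by simp at hq)]
    refine ⟨by omega, ?_, hvn⟩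
    simpa only [levelField, Nat.lt_succ_iff] using hv

theorem levelField_update_of_le (y : ℕ → E) (e : ℕ → ℕ) (q k : ℕ) (v : E) :
    levelField B z D m (Function.update y q v) (Function.update e q (k + 1)) (q + 1) k =
      levelField B z D m y e q k := by
  have : {l | l < q + 1 ∧ Function.update e q (k + 1) l ≤ k} = {l | l < q ∧ e l ≤ k} := by
    ext l
    simp only [Set.mem_ofPred_eq]
    rcases eq_or_ne l q with rfl | hl
    · simp
    · rw [Function.update_of_ne hl]; omega
  rw [levelField, levelField, this]
  congr 2
  exact Set.image_congr fun l hl => Function.update_of_ne (by have := hl.1; omega) _ _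

theorem levelField_update_succ (y : ℕ → E) (e : ℕ → ℕ) (q k : ℕ) (v : E) :
    levelField B z D m (Function.update y q v) (Function.update e q (k + 1)) (q + 1) (k + 1) =
      adj (levelField B z D m y e q (k + 1)) {v} := by
  have : {l | l < q + 1 ∧ Function.update e q (k + 1) l ≤ k + 1} =
      insert q {l | l < q ∧ e l ≤ k + 1} := by
    ext l
    simp only [Set.mem_ofPred_eq, Set.mem_insert_iff]
    rcases eq_or_ne l q with rfl | hl
    · simp
    · rw [Function.update_of_ne hl]; omega
  rw [levelField, levelField, this, adj_adj, Set.image_insert_eq, Function.update_self,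
    Set.union_assoc, Set.union_singleton]
  congr 3
  exact Set.image_congr fun l hl => Function.update_of_ne (by have := hl.1; omega) _ _

theorem adj_levelField (y : ℕ → E) {e : ℕ → ℕ} {q k : ℕ} (he : ∀ j < q, e j ≤ k) :
    adj (levelField B z D m y e q k) (z '' {i | (i : ℕ) < m}) =
      adj B (z '' {i | (i : ℕ) < m} ∪ y '' {l | l < q}) := by
  have : {l | l < q ∧ e l ≤ k} = {l | l < q} := by
    ext l; exact ⟨fun h => h.1, fun h => ⟨h, he l h⟩⟩
  rw [levelField, adj_adj, this, Set.union_right_comm, ← Set.image_union]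
  congr 3
  ext l
  simp only [Set.mem_union, Set.mem_ofPred_eq]
  tauto

/-- Each `v ∈ Y` is either present or becomes the next `y`, with level `k + 1` because its
difference lies in the level `k` field `K`, which does not change. The bound by `S` records which
generators `M'` may involve, so that the others stay transcendental over it. -/
theorem exists_tower_of_finset [CharZero E] (hz : GradedTower σ B z D) (hm : m ≤ N) {k : ℕ}
    (hM : Stable σ M) (hc : TeleClosed σ K M) {S : Set (Fin N)} (hS : ∀ i ∈ S, D i ≤ k + 1)
    (Y : Finset E) (hY : ∀ v ∈ Y, v ∈ adj B (z '' S) ∧ σ v - v ∈ K)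
    {y₀ : ℕ → E} {e₀ : ℕ → ℕ} {q₀ : ℕ} {M₀ : Subfield E}
    (h0 : IsSigmaTower σ B z D m y₀ e₀ q₀) (he0 : ∀ j < q₀, e₀ j ≤ k + 1)
    (hK0 : levelField B z D m y₀ e₀ q₀ k = K)
    (hP0 : PairExt σ K M (levelField B z D m y₀ e₀ q₀ (k + 1)) M₀) (hM0 : M₀ ≤ adj B (z '' S)) :
    ∃ (y : ℕ → E) (e : ℕ → ℕ) (q : ℕ) (M' : Subfield E), IsSigmaTower σ B z D m y e q ∧
      (∀ j < q, e j ≤ k + 1) ∧ levelField B z D m y e q k = K ∧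
      PairExt σ K M (levelField B z D m y e q (k + 1)) M' ∧ M₀ ≤ M' ∧ M' ≤ adj B (z '' S) ∧
      (Y : Set E) ⊆ levelField B z D m y e q (k + 1) := by
  classical
  induction Y using Finset.induction_on with
  | empty => exact ⟨y₀, e₀, q₀, M₀, h0, he0, hK0, hP0, le_rfl, hM0, by simp⟩
  | insert v Y _ ih =>
    obtain ⟨y, e, q, M', h1, h2, h3, h4, h5, h6, h7⟩ :=
      ih fun w hw => hY w (Finset.mem_insert_of_mem hw)
    obtain ⟨hvS, hvK⟩ := hY v (Finset.mem_insert_self v Y)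
    by_cases hv : v ∈ levelField B z D m y e q (k + 1)
    · refine ⟨y, e, q, M', h1, h2, h3, h4, h5, h6, ?_⟩
      rw [Finset.coe_insert]
      exact Set.insert_subset hv h7
    · have hBk : adj B (z '' S) ≤ adj B (z '' {i | D i ≤ k + 1}) := adj_image_mono hS
      have hvn : v ∉ adj B (z '' {i | (i : ℕ) < m} ∪ y '' {l | l < q}) := by
        rw [← adj_levelField y h2]
        intro hmem
        refine hv (hz.mem_of_mem_adj hm (h4.tow.le.trans (h6.trans hBk)) ?_ (hBk hvS) hmem)
        exact fun i hi hik => mem_adj_of_mem (Or.inl ⟨i, ⟨hi, hik⟩, rfl⟩)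
      have hBK : B ≤ levelField B z D m y e q (k + 1) := le_adj _
      refine ⟨Function.update y q v, Function.update e q (k + 1), q + 1, adj M' {v},
        h1.update (by rwa [h3]) hvn, ?_, by rw [levelField_update_of_le, h3], ?_,
        h5.trans (le_adj _), adj_le h6 (Set.singleton_subset_iff.2 hvS), ?_⟩
      · intro j hj
        rcases Nat.lt_succ_iff_lt_or_eq.1 hj with hj | rfl
        · rw [Function.update_of_ne hj.ne]; exact h2 j hj
        · rw [Function.update_self]
      · rw [levelField_update_succ]
        exact h4.adjoin_sigma hM hc (fun c hc => hBK (hz.const c hc))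
          (a := σ v - v) ⟨one_mem _, one_ne_zero, h4.le_left hvK, by ring⟩
      · rw [levelField_update_succ, Finset.coe_insert]
        exact Set.insert_subset mem_adj_self (h7.trans (le_adj _))

/-- The coefficients of these steps involve only generators of depth at most `k` with index below
`m`, all of which lie in `K`. -/
theorem GradedTower.exists_pairExt [CharZero E] (hz : GradedTower σ B z D) {k : ℕ}
    (hBK : B ≤ K) (hK : Stable σ K) (hT : Tow σ K (adj B (z '' {i | D i ≤ k})))
    (hc : TeleClosed σ K (adj B (z '' {i | D i ≤ k})))
    (hzK : ∀ i : Fin N, (i : ℕ) < m → D i ≤ k → z i ∈ K) (S : Finset (Fin N))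
    (hS : ∀ i ∈ S, (i : ℕ) < m ∧ D i = k + 1) :
    PairExt σ K (adj B (z '' {i | D i ≤ k})) (adj K (z '' S))
      (adj (adj B (z '' {i | D i ≤ k})) (z '' S)) := by
  classical
  induction S using Finset.induction_on with
  | empty =>
    rw [Finset.coe_empty, Set.image_empty, adj_eq_self (Set.empty_subset _),
      adj_eq_self (Set.empty_subset _)]
    exact .refl hK hT
  | insert i S hi ih =>
    rw [Finset.coe_insert, adj_image_insert, adj_image_insert]
    obtain ⟨him, hik⟩ := hS i (Finset.mem_insert_self i S)
    refine (ih fun j hj => hS j (Finset.mem_insert_of_mem hj)).adjoin_gen hz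
      (hBK.trans (le_adj _)) (hT.stable hK) hc (S := {i | D i ≤ k} ∪ S) ?_ ?_ ?_
    · rw [adj_adj, ← Set.image_union]
    · simp only [Set.mem_union, Set.mem_ofPred_eq, Finset.mem_coe, not_or]
      exact ⟨by omega, hi⟩
    · intro l hl hDl
      exact le_adj _ (hzK l (lt_trans (Fin.lt_def.1 hl) him) (by omega))

theorem sub_mem_of_mem_span {K : Subfield E} (hC : ∀ c, σ c = c → c ∈ K) {S : Set E}
    (hS : ∀ x ∈ S, σ x - x ∈ K) {v : E} (hv : v ∈ Submodule.span (constField σ) S) :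
    σ v - v ∈ K := by
  induction hv using Submodule.span_induction with
  | mem x hx => exact hS x hx
  | zero => simp
  | add x y _ _ hx hy =>
    have : σ (x + y) - (x + y) = (σ x - x) + (σ y - y) := by rw [map_add]; ring
    rw [this]; exact add_mem hx hy
  | smul c x _ hx =>
    have : σ (c • x) - c • x = c * (σ x - x) := by
      change σ ((c : E) * x) - c * x = _
      rw [map_mul, mem_constField.1 c.2]; ring
    rw [this]; exact mul_mem (hC c (mem_constField.1 c.2)) hx

theorem mem_of_mem_span {K : Subfield E} (hC : ∀ c, σ c = c → c ∈ K) {S : Set E} (hS : S ⊆ K)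
    {v : E} (hv : v ∈ Submodule.span (constField σ) S) : v ∈ K := by
  induction hv using Submodule.span_induction with
  | mem x hx => exact hS hx
  | zero => exact zero_mem _
  | add x y _ _ hx hy => exact add_mem hx hy
  | smul c x _ hx => exact mul_mem (hC c (mem_constField.1 c.2)) hx

/-- The elements of `M` whose difference lies in `K`, as a vector space over the constants. -/
def telescoping (σ : E ≃+* E) (K M : Subfield E) (hK : ∀ c, σ c = c → c ∈ K) (hKM : K ≤ M) :
    Submodule (constField σ) E where
  carrier := {g | g ∈ M ∧ σ g - g ∈ K}
  add_mem' {x y} hx hy := ⟨add_mem hx.1 hy.1, by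
    have : σ (x + y) - (x + y) = (σ x - x) + (σ y - y) := by rw [map_add]; ring
    rw [this]; exact add_mem hx.2 hy.2⟩
  zero_mem' := ⟨zero_mem _, by simp⟩
  smul_mem' c x hx := ⟨mul_mem (hKM (hK c (mem_constField.1 c.2))) hx.1, by
    have : σ (c • x) - c • x = c * (σ x - x) := by
      change σ ((c : E) * x) - c * x = _
      rw [map_mul, mem_constField.1 c.2]; ring
    rw [this]; exact mul_mem (hK c (mem_constField.1 c.2)) hx.2⟩

/-- A subfield that contains the constants, as a vector space over the constants. -/
def subfieldSubmodule (σ : E ≃+* E) (K : Subfield E) (hK : ∀ c, σ c = c → c ∈ K) :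
    Submodule (constField σ) E where
  carrier := K
  add_mem' := add_mem
  zero_mem' := zero_mem K
  smul_mem' c _ hx := mul_mem (hK c (mem_constField.1 c.2)) hx

end Core

/-! ### Induction on the depth. -/

section Levels

variable {E : Type*} [Field E] {σ : E ≃+* E} {N : ℕ} {B : Subfield E} {z : Fin N → E}
  {D : Fin N → ℕ} {m : ℕ}

theorem GradedTower.stable_le (hz : GradedTower σ B z D) (k : ℕ) :
    Stable σ (adj B (z '' {i | D i ≤ k})) :=
  hz.stable_adj fun _ hi _ _ hl => hl.le.trans hi

theorem GradedTower.affine_le (hz : GradedTower σ B z D) {k : ℕ} {i : Fin N} (hi : D i = k + 1) :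
    ∃ α a, Affine σ (adj B (z '' {i | D i ≤ k})) (z i) α a ∧ (α = 1 ∨ a = 0) := by
  obtain ⟨α, a, hA, h⟩ := hz.step i
  refine ⟨α, a, hA.mono (adj_image_mono fun l hl => ?_), h⟩
  have := hl.2
  simp only [Set.mem_ofPred_eq]
  omega

theorem setOf_le_succ (D : Fin N → ℕ) (k : ℕ) :
    {i | D i ≤ k + 1} = {i | D i ≤ k} ∪ {i | D i = k + 1} := by
  ext i
  simp only [Set.mem_ofPred_eq, Set.mem_union]
  omega

theorem levelField_succ (y : ℕ → E) {e : ℕ → ℕ} {q k : ℕ} (he : ∀ j < q, e j ≤ k) :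
    levelField B z D m y e q (k + 1) =
      adj (levelField B z D m y e q k) (z '' {i | (i : ℕ) < m ∧ D i = k + 1}) := by
  have h1 : {l | l < q ∧ e l ≤ k} = {l | l < q ∧ e l ≤ k + 1} := by
    ext l
    exact and_congr_right fun h => iff_of_true (he l h) ((he l h).trans k.le_succ)
  rw [levelField, levelField, adj_adj, h1, Set.union_right_comm, ← Set.image_union]
  congr 3
  ext i
  simp only [Set.mem_ofPred_eq, Set.mem_union]
  omega

/-- The tower property is carried along with closure because adjoining `Π`-type elements to a pair
depends on it. -/
theorem exists_level [CharZero E] (hz : GradedTower σ B z D) (hm : m ≤ N) (k : ℕ) :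
    ∃ (y : ℕ → E) (e : ℕ → ℕ) (q : ℕ), IsSigmaTower σ B z D m y e q ∧ (∀ j < q, e j ≤ k) ∧
      Stable σ (levelField B z D m y e q k) ∧
      Tow σ (levelField B z D m y e q k) (adj B (z '' {i | D i ≤ k})) ∧
      TeleClosed σ (levelField B z D m y e q k) (adj B (z '' {i | D i ≤ k})) := by
  classical
  induction k with
  | zero =>
    have h1 : {i : Fin N | D i ≤ 0} = ∅ := Set.eq_empty_of_forall_notMem fun i (hi : D i ≤ 0) => by
      have := hz.pos i
      omega
    have h2 : levelField B z D m (fun _ => 0) (fun _ => 0) 0 0 = B := by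
      refine adj_eq_self ?_
      rintro x (⟨i, ⟨-, hi⟩, -⟩ | ⟨i, ⟨hi, -⟩, -⟩)
      · have := hz.pos i
        have : D i ≤ 0 := hi
        omega
      · exact absurd hi (Nat.not_lt_zero i)
    refine ⟨fun _ => 0, fun _ => 0, 0, fun j hj => by omega, fun j hj => by omega, ?_⟩
    rw [h2, h1, Set.image_empty, adj_eq_self (Set.empty_subset _)]
    exact ⟨hz.stable, .refl, fun g hg _ => hg⟩
  | succ k ih =>
    obtain ⟨y, e, q, h1, h2, hK, hT, hc⟩ := ih
    set K := levelField B z D m y e q k with hKdef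
    set M := adj B (z '' {i | D i ≤ k}) with hMdef
    have hM : Stable σ M := hz.stable_le k
    have hBK : B ≤ K := le_adj _
    have hBM : B ≤ M := le_adj _
    have hCK : ∀ c, σ c = c → c ∈ K := fun c hc => hBK (hz.const c hc)
    have hCM : ∀ c, σ c = c → c ∈ M := fun c hc => hBM (hz.const c hc)
    set T : Finset (Fin N) := Finset.univ.filter fun i => (i : ℕ) < m ∧ D i = k + 1
    set S : Finset (Fin N) := Finset.univ.filter fun i => D i = k + 1
    set Sg : Set (Fin N) := {i | σ (z i) - z i ∈ M}
    have hTc : (T : Set (Fin N)) = {i : Fin N | (i : ℕ) < m ∧ D i = k + 1} := by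
      ext; simp [T]
    have hSc : (S : Set (Fin N)) = {i : Fin N | D i = k + 1} := by ext; simp [S]
    have hsg : ∀ i ∈ Sg, Affine σ M (z i) 1 (σ (z i) - z i) := fun i hi =>
      ⟨one_mem _, one_ne_zero, hi, by ring⟩
    have hpi : ∀ i : Fin N, D i = k + 1 → i ∉ Sg → ∃ α, Affine σ M (z i) α 0 := by
      intro i hi hn
      obtain ⟨α, a, hA, rfl | rfl⟩ := hz.affine_le hi
      · exfalso
        refine hn ?_
        simp only [Sg, Set.mem_ofPred_eq]
        rw [hA.map_eq, one_mul, add_sub_cancel_left]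
        exact hA.add_mem
      · exact ⟨α, hA⟩
    have hE : adj B (z '' {i | D i ≤ k + 1}) = adj M (z '' S) := by
      rw [setOf_le_succ, Set.image_union, ← adj_adj, hSc]
    have hMcompl : ∀ i : Fin N, D i = k + 1 → M ≤ adj B (z '' {i}ᶜ) := fun i hi =>
      adj_image_mono fun l hl => by
        rintro rfl
        simp only [Set.mem_ofPred_eq] at hl
        omega
    obtain ⟨-, -, htele⟩ := stable_and_tow_adj_finset hM hCM hz.trans Sg S (by
      intro i hi
      have hi' : D i = k + 1 := by simpa [S] using hi
      by_cases hiS : i ∈ Sg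
      · exact Or.inr (Or.inl ⟨hiS, _, hsg i hiS⟩)
      · exact Or.inr (Or.inr ⟨hpi i hi' hiS, hMcompl i hi'⟩))
    have hKE : K ≤ adj M (z '' S) := hT.le.trans (le_adj _)
    -- Finitely many solutions of telescoping equations over `K` that span all of them modulo `M`.
    obtain ⟨Y, hYW, hY⟩ := Submodule.exists_finset_span_sub_mem
      (W := telescoping σ K (adj M (z '' S)) hCK hKE) (M := subfieldSubmodule σ M hCM)
      (U := Submodule.span (constField σ) (z '' (S ∩ Sg)))
      (Submodule.fg_span (Set.toFinite _)) fun w hw => htele w hw.1 (hT.le hw.2)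
    -- This leaves out the `Π`-type generators of depth `k + 1` with index at least `m`, which
    -- therefore remain transcendental over `M'`. The elements of `Y` involve only `Σ`-type
    -- generators and `M`.
    set S' : Set (Fin N) := {i | D i ≤ k ∨ (D i = k + 1 ∧ ((i : ℕ) < m ∨ i ∈ Sg))} with hS'
    have hMS' : M ≤ adj B (z '' S') := adj_image_mono fun l hl => Or.inl hl
    obtain ⟨y', e', q', M', t1, t2, t3, t4, t5, t6, t7⟩ :=
      exists_tower_of_finset (K := K) (M := M) (S := S') hz hm hM hc (k := k) (by
        rintro i (hi | hi) <;> omega) Y (by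
        intro v hv
        have hvW := hYW hv
        refine ⟨?_, hvW.2⟩
        obtain ⟨u, hu, huv⟩ := htele v hvW.1 (hT.le hvW.2)
        have : u ∈ adj B (z '' S') := by
          refine mem_of_mem_span (fun c hc => le_adj _ (hz.const c hc)) ?_ hu
          rintro _ ⟨i, ⟨hi, hiS⟩, rfl⟩
          exact gen_mem_adj (Or.inr ⟨by simpa [S] using hi, Or.inr hiS⟩)
        have := add_mem (hMS' huv) this
        rwa [sub_add_cancel] at this)
        (M₀ := adj M (z '' T)) h1 (fun j hj => (h2 j hj).trans k.le_succ) rfl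
        (by
          rw [levelField_succ y h2, ← hTc]
          exact hz.exists_pairExt hBK hK hT hc
            (fun i hi hik => mem_adj_of_mem (Or.inl ⟨i, ⟨hi, hik⟩, rfl⟩)) T
            (fun i hi => by simpa [T] using hi))
        (adj_le hMS' (by
          rintro _ ⟨i, hi, rfl⟩
          have hi' : (i : ℕ) < m ∧ D i = k + 1 := by simpa [T] using hi
          exact gen_mem_adj (Or.inr ⟨hi'.2, Or.inl hi'.1⟩)))
    set K' := levelField B z D m y' e' q' (k + 1) with hK'
    have hBK' : B ≤ K' := le_adj _
    have hCK' : ∀ c, σ c = c → c ∈ K' := fun c hc => hBK' (hz.const c hc)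
    have hM' : Stable σ M' := t4.tow.stable t4.stable
    have hMM' := t4.le_right
    -- Modulo the span of `Y`, such a `g` lies in `M` with difference in `K`, hence in `K` by the
    -- induction hypothesis.
    have hW : ∀ g ∈ adj M (z '' S), σ g - g ∈ K → g ∈ K' := by
      intro g hg hgK
      obtain ⟨v, hv, hgv⟩ := hY g ⟨hg, hgK⟩
      have hvK : σ v - v ∈ K := sub_mem_of_mem_span hCK (fun x hx => (hYW hx).2) hv
      have h3 : g - v ∈ K := by
        refine hc _ hgv ?_
        have : σ (g - v) - (g - v) = (σ g - g) - (σ v - v) := by rw [map_sub]; ring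
        rw [this]
        exact sub_mem hgK hvK
      have := add_mem (t4.le_left h3) (mem_of_mem_span hCK' t7 hv)
      rwa [sub_add_cancel] at this
    have hE' : adj B (z '' {i | D i ≤ k + 1}) = adj M' (z '' S) := by
      refine le_antisymm (hE.le.trans (adj_mono hMM' le_rfl)) (adj_le (t6.trans ?_) ?_)
      · refine adj_image_mono ?_
        rintro i (hi | hi) <;> simp only [Set.mem_ofPred_eq] <;> omega
      · rintro _ ⟨i, hi, rfl⟩
        have : D i = k + 1 := by simpa [S] using hi
        exact gen_mem_adj this.le
    obtain ⟨-, htow, htele'⟩ := stable_and_tow_adj_finset hM' (fun c hc => hMM' (hCM c hc))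
      hz.trans Sg S (by
        intro i hi
        have hi' : D i = k + 1 := by simpa [S] using hi
        by_cases hiS : i ∈ Sg
        · exact Or.inr (Or.inl ⟨hiS, _, (hsg i hiS).mono hMM'⟩)
        · by_cases him : (i : ℕ) < m
          · exact Or.inl (t5 (mem_adj_of_mem ⟨i, by simp [T, him, hi'], rfl⟩))
          · obtain ⟨α, hα⟩ := hpi i hi' hiS
            refine Or.inr (Or.inr ⟨⟨α, hα.mono hMM'⟩, t6.trans (adj_image_mono ?_)⟩)
            rintro l hl rfl
            rcases hl with hl | ⟨-, hl | hl⟩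
            · omega
            · exact him hl
            · exact hiS hl)
    refine ⟨y', e', q', t1, t2, t4.stable, ?_, ?_⟩
    · rw [hE']
      exact htow _ t4.tow
    -- Modulo `M'`, `g` is a combination `v` of `Σ`-type generators, and the difference of `v` lies
    -- in `M`. This is an error that `tele` allows, so `g - v` splits into `w ∈ M` and a part in
    -- `K'`. Then `v + w` has its difference in `K' ∩ M = K`, and `hW` applies.
    · intro g hg hgK
      rw [hE'] at hg
      obtain ⟨v, hv, hgv⟩ := htele' g hg (t4.tow.le hgK)
      have hvM : σ v - v ∈ M := sub_mem_of_mem_span hCM (by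
        rintro _ ⟨i, ⟨-, hi⟩, rfl⟩
        exact hi) hv
      obtain ⟨w, hw, hgw⟩ := t4.tele _ hgK (g - v) hgv (by
        have : σ g - g - (σ (g - v) - (g - v)) = σ v - v := by rw [map_sub]; ring
        rwa [this])
      have hg1 : g - (g - v - w) = v + w := by ring
      have hΔ : σ (v + w) - (v + w) = (σ v - v) + (σ w - w) := by rw [map_add]; ring
      have hvw : v + w ∈ K' := by
        refine hW _ ?_ (t4.inter _ ?_ ?_)
        · refine add_mem ?_ (le_adj _ hw)
          refine mem_of_mem_span (fun c hc => le_adj _ (hCM c hc)) ?_ hv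
          rintro _ ⟨i, ⟨hi, -⟩, rfl⟩
          exact gen_mem_adj hi
        · rw [← hg1, map_sub, sub_sub_sub_comm]
          exact sub_mem hgK (sub_mem ((t4.stable _).2 hgw) hgw)
        · rw [hΔ]
          exact add_mem hvM (sub_mem ((hM w).2 hw) hw)
      have := add_mem hgw hvw
      rwa [← hg1, add_sub_cancel] at this

/-- If all `z i` with `m ≤ i` have depth at most `d`, then the telescoping equations over the field
generated by the `z i`, `i < m`, that have a solution in the field generated by all `z i` have it
in a tower of `Σ`-adjunctions of depth at most `d`. -/
theorem exists_isSigmaTower [CharZero E] (hz : GradedTower σ B z D) (hm : m ≤ N) {d : ℕ}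
    (hd : ∀ i : Fin N, m ≤ i → D i ≤ d) (htop : adj B (z '' Set.univ) = ⊤) :
    ∃ (y : ℕ → E) (e : ℕ → ℕ) (q : ℕ), IsSigmaTower σ B z D m y e q ∧ (∀ j < q, e j ≤ d) ∧
      ∀ g, σ g - g ∈ adj B (z '' {i | (i : ℕ) < m}) →
        g ∈ adj B (z '' {i | (i : ℕ) < m} ∪ y '' {l | l < q}) := by
  obtain ⟨y, e, q, h1, h2, hK, hT, hc⟩ := exists_level hz hm d
  refine ⟨y, e, q, h1, h2, fun g hg => ?_⟩
  set K := levelField B z D m y e q d with hKdef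
  set M := adj B (z '' {i | D i ≤ d}) with hMdef
  have hM : Stable σ M := hz.stable_le d
  have hBK : B ≤ K := le_adj _
  -- Generators of depth at most `d` are already in `K`; each deeper one is transcendental over `M`
  -- with the earlier generators adjoined.
  have key : ∀ j : ℕ, j ≤ m → PairExt σ K M (adj K (z '' {i | (i : ℕ) < j}))
      (adj M (z '' {i | (i : ℕ) < j})) := by
    intro j
    induction j with
    | zero =>
      intro _
      have : {i : Fin N | (i : ℕ) < 0} = ∅ := by ext; simp
      rw [this, Set.image_empty, adj_eq_self (Set.empty_subset _),
        adj_eq_self (Set.empty_subset _)]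
      exact .refl hK hT
    | succ j ih =>
      intro hj
      set i : Fin N := ⟨j, by omega⟩ with hi
      have hset : {l : Fin N | (l : ℕ) < j + 1} = insert i {l : Fin N | (l : ℕ) < j} := by
        ext l
        simp only [Set.mem_ofPred_eq, Set.mem_insert_iff, hi, Fin.ext_iff]
        omega
      rw [hset, adj_image_insert, adj_image_insert]
      by_cases hDi : D i ≤ d
      · have hziK : z i ∈ K :=
          mem_adj_of_mem (Or.inl ⟨i, ⟨by simp only [hi]; omega, hDi⟩, rfl⟩)
        rw [adj_eq_self (Set.singleton_subset_iff.2 (le_adj _ hziK)),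
          adj_eq_self (Set.singleton_subset_iff.2 (le_adj _ (hT.le hziK)))]
        exact ih (by omega)
      · refine (ih (by omega)).adjoin_gen hz (hBK.trans (le_adj _)) hM hc
          (S := {l | D l ≤ d} ∪ {l : Fin N | (l : ℕ) < j}) ?_ ?_ ?_
        · rw [adj_adj, ← Set.image_union]
        · simp only [Set.mem_union, Set.mem_ofPred_eq, not_or, hi]
          exact ⟨hDi, lt_irrefl j⟩
        · intro l hl _
          exact gen_mem_adj (Fin.lt_def.1 hl)
  have hfin := (key m le_rfl).closed hM hc
  rw [adj_levelField y h2] at hfin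
  refine hfin g ?_ (adj_mono le_rfl Set.subset_union_left hg)
  have : adj M (z '' {i | (i : ℕ) < m}) = ⊤ := by
    rw [← htop, hMdef, adj_adj, ← Set.image_union]
    congr 2
    ext i
    simp only [Set.mem_union, Set.mem_ofPred_eq, Set.mem_univ, iff_true]
    rcases lt_or_ge (i : ℕ) m with h | h
    · exact Or.inr h
    · exact Or.inl (hd i h)
  rw [this]
  exact Subfield.mem_top g

end Levels

/-! ### Occurrence of variables versus membership in generated subfields. -/

section Depth

open MvPolynomial

variable {G E : Type u} [Field G] [Field E] {ι : G →+* E} {N : ℕ} {z : Fin N → E}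

theorem eval₂_mem_adj {p : MvPolynomial (Fin N) G} {S : Set (Fin N)}
    (hp : (p.vars : Set (Fin N)) ⊆ S) : p.eval₂ ι z ∈ adj ι.fieldRange (z '' S) := by
  rw [eval₂_eq]
  refine sum_mem fun d hd => mul_mem (le_adj _ ⟨_, rfl⟩) (prod_mem fun i hi => pow_mem ?_ _)
  exact gen_mem_adj (hp ((mem_vars_iff_mem_support i).2 ⟨d, hd, hi⟩))

theorem exists_eval₂_of_mem_adj {S : Set (Fin N)} {x : E}
    (h : x ∈ adj ι.fieldRange (z '' S)) : ∃ p ∈ supported G S, ∃ q ∈ supported G S,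
      q.eval₂ ι z ≠ 0 ∧ x = p.eval₂ ι z / q.eval₂ ι z := by
  induction h using Subfield.closure_induction with
  | mem x hx =>
    rcases hx with ⟨g, rfl⟩ | ⟨i, hi, rfl⟩
    · exact ⟨C g, Subalgebra.algebraMap_mem _ g, 1, one_mem _, by simp, by simp⟩
    · exact ⟨X i, (X_mem_supported (R := G)).2 hi, 1, one_mem _, by simp, by simp⟩
  | one => exact ⟨1, one_mem _, 1, one_mem _, by simp, by simp⟩
  | add a b _ _ ha hb =>
    obtain ⟨p, hp, q, hq, h0, rfl⟩ := ha
    obtain ⟨p', hp', q', hq', h0', rfl⟩ := hb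
    exact ⟨p * q' + q * p', add_mem (mul_mem hp hq') (mul_mem hq hp'), q * q', mul_mem hq hq',
      by simp [h0, h0', eval₂_mul], by simp [eval₂_mul, eval₂_add, div_add_div _ _ h0 h0']⟩
  | neg a _ ha =>
    obtain ⟨p, hp, q, hq, h0, rfl⟩ := ha
    exact ⟨-p, neg_mem hp, q, hq, h0, by simp [neg_div, ← coe_eval₂Hom]⟩
  | inv a _ ha =>
    obtain ⟨p, hp, q, hq, h0, rfl⟩ := ha
    by_cases hp0 : p.eval₂ ι z = 0
    · exact ⟨0, zero_mem _, 1, one_mem _, by simp, by simp [hp0]⟩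
    · exact ⟨q, hq, p, hp, hp0, by simp⟩
  | mul a b _ _ ha hb =>
    obtain ⟨p, hp, q, hq, h0, rfl⟩ := ha
    obtain ⟨p', hp', q', hq', h0', rfl⟩ := hb
    exact ⟨p * p', mul_mem hp hp', q * q', mul_mem hq hq', by simp [h0, h0', eval₂_mul],
      by simp [eval₂_mul, div_mul_div_comm]⟩

theorem MvPolynomial.vars_subset_of_dvd {p q : MvPolynomial (Fin N) G} (h : p ∣ q) (hq : q ≠ 0) :
    p.vars ⊆ q.vars := by
  obtain ⟨r, rfl⟩ := h
  intro i hi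
  rw [mem_vars_iff_degreeOf_ne_zero] at hi ⊢
  rw [degreeOf_mul_eq (left_ne_zero_of_mul hq) (right_ne_zero_of_mul hq)]
  omega

/-- Cancelling common factors gives one reduced fraction for `x`, and it involves only variables
that occur. -/
theorem mem_adj_of_occurs {S : Set (Fin N)} {x : E} (hx : x ∈ adj ι.fieldRange (z '' Set.univ))
    (h : ∀ j, Occurs ι z j x → j ∈ S) : x ∈ adj ι.fieldRange (z '' S) := by
  obtain ⟨p, -, q, -, h0, rfl⟩ := exists_eval₂_of_mem_adj hx
  have hq0 : q ≠ 0 := by rintro rfl; simp at h0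
  obtain ⟨q', p', c, hrel, rfl, rfl⟩ := UniqueFactorizationMonoid.exists_reduced_factors q hq0 p
  rw [eval₂_mul] at h0
  have hc := left_ne_zero_of_mul h0
  have hq' := right_ne_zero_of_mul h0
  have e : (c * p').eval₂ ι z / (c * q').eval₂ ι z = p'.eval₂ ι z / q'.eval₂ ι z := by
    rw [eval₂_mul, eval₂_mul, mul_div_mul_left _ _ hc]
  rw [e] at h ⊢
  exact div_mem (eval₂_mem_adj fun j hj => h j ⟨p', q', hrel.symm, hq', rfl, Or.inl hj⟩)
    (eval₂_mem_adj fun j hj => h j ⟨p', q', hrel.symm, hq', rfl, Or.inr hj⟩)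

/-- By algebraic independence, numerator and denominator of a reduced fraction divide those of any
other representation, and a divisor of a nonzero polynomial involves no further variables. -/
theorem Occurs.mem (hinj : ∀ p : MvPolynomial (Fin N) G, p.eval₂ ι z = 0 → p = 0)
    {S : Set (Fin N)} {x : E} (hx : x ∈ adj ι.fieldRange (z '' S)) {j : Fin N}
    (h : Occurs ι z j x) : j ∈ S := by
  obtain ⟨P, hP, Q, hQ, hQ0, rfl⟩ := exists_eval₂_of_mem_adj hx
  obtain ⟨p, q, hrel, hq0, he, hj⟩ := h
  rw [mem_supported] at hP hQ
  have heq : P * q = p * Q := by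
    rw [← sub_eq_zero]
    refine hinj _ ?_
    rw [div_eq_div_iff hQ0 hq0] at he
    rw [← coe_eval₂Hom, map_sub, map_mul, map_mul, coe_eval₂Hom, he, sub_self]
  have hQne : Q ≠ 0 := by rintro rfl; simp at hQ0
  have hqQ : q ∣ Q := hrel.symm.dvd_of_dvd_mul_left ⟨P, by rw [← heq, mul_comm]⟩
  rcases hj with hj | hj
  · have hpP : p ∣ P := hrel.dvd_of_dvd_mul_right ⟨Q, heq⟩
    have hP0 : P ≠ 0 := by
      rintro rfl
      rw [zero_mul] at heq
      rw [(mul_eq_zero.1 heq.symm).resolve_right hQne] at hj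
      simp at hj
    exact hP (MvPolynomial.vars_subset_of_dvd hpP hP0 hj)
  · exact hQ (MvPolynomial.vars_subset_of_dvd hqQ hQne hj)

end Depth

/-! ### From `ΠΣ*`-extensions to graded towers. -/

section Stage

variable {G E : Type u} [Field G] [Field E] {ι : G →+* E} {N : ℕ} {z : Fin N → E}
  {σG : G ≃+* G} {σ : E ≃+* E}

theorem stage_eq_adj (ι : G →+* E) (z : Fin N → E) (i : ℕ) :
    stage ι z i = adj ι.fieldRange (z '' {j | (j : ℕ) < i}) := rfl

theorem stage_succ (ι : G →+* E) (z : Fin N → E) (i : Fin N) :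
    stage ι z (i + 1) = adj (stage ι z i) {z i} := by
  rw [stage_eq_adj, stage_eq_adj, ← adj_image_insert]
  congr 2
  ext l
  simp only [Set.mem_ofPred_eq, Set.mem_insert_iff, Fin.ext_iff]
  omega

namespace IsPiSigmaExt

variable (h : IsPiSigmaExt σG σ ι z)
include h

theorem transOver_stage (i : Fin N) : TransOver (stage ι z i) (z i) := by
  rcases h.steps i with h | h <;> exact transOver_iff.2 h.transcendental

theorem fixed_mem_stage (i : Fin N) {c : E} (hc : c ∈ stage ι z (i + 1)) (hσ : σ c = c) :
    c ∈ stage ι z i := by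
  rw [stage_succ] at hc
  rcases h.steps i with h | h <;> exact h.constants c hc hσ

theorem fixed_mem_range {c : E} (hσ : σ c = c) : c ∈ ι.fieldRange := by
  have key : ∀ k : ℕ, k ≤ N → c ∈ stage ι z k → c ∈ stage ι z 0 := by
    intro k
    induction k with
    | zero => exact fun _ h => h
    | succ k ih => exact fun hk hc => ih (by omega) (h.fixed_mem_stage ⟨k, hk⟩ hc hσ)
  have := key N le_rfl (by rw [h.generates]; exact Subfield.mem_top c)
  have h0 : {j : Fin N | (j : ℕ) < 0} = ∅ := by ext; simp
  rwa [stage_eq_adj, h0, Set.image_empty, adj_eq_self (Set.empty_subset _)] at this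

theorem algebraicIndependent :
    letI := ι.toAlgebra
    AlgebraicIndependent G z := by
  let _ := ι.toAlgebra
  have key : ∀ k : ℕ, k ≤ N → AlgebraicIndepOn G z {l : Fin N | (l : ℕ) < k} := by
    intro k
    induction k with
    | zero =>
      intro _
      have h0 : {l : Fin N | (l : ℕ) < 0} = ∅ := by ext; simp
      rw [h0]
      have : IsEmpty (∅ : Set (Fin N)) := inferInstance
      rw [AlgebraicIndepOn, algebraicIndependent_empty_type_iff]
      exact ι.injective
    | succ k ih =>
      intro hk
      have hset : {l : Fin N | (l : ℕ) < k + 1} = insert ⟨k, hk⟩ {l : Fin N | (l : ℕ) < k} := by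
        ext l
        simp only [Set.mem_ofPred_eq, Set.mem_insert_iff, Fin.ext_iff]
        omega
      rw [hset]
      exact (ih (by omega)).insert (transOver_closure_iff.1 (h.transOver_stage ⟨k, hk⟩))
  exact (key N le_rfl).comp (fun l : Fin N => ⟨l, l.2⟩) fun _ _ h => congrArg Subtype.val h

theorem transOver_adj (S : Set (Fin N)) (j : Fin N) (hj : j ∉ S) :
    TransOver (adj ι.fieldRange (z '' S)) (z j) := by
  let _ := ι.toAlgebra
  exact transOver_closure_iff.2 (h.algebraicIndependent.transcendental_adjoin hj)

theorem eval₂_injective (p : MvPolynomial (Fin N) G) (hp : p.eval₂ ι z = 0) : p = 0 := by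
  let _ := ι.toAlgebra
  exact (injective_iff_map_eq_zero _).1 h.algebraicIndependent p hp

theorem occurs_mem {S : Set (Fin N)} {x : E} (hx : x ∈ adj ι.fieldRange (z '' S)) {j : Fin N}
    (hj : Occurs ι z j x) : j ∈ S :=
  Occurs.mem h.eval₂_injective hx hj

/-- The data of the `i`-th step, with coefficients in some part of the `i`-th stage, determine
`stepCoeff`. -/
theorem stepCoeff_mem {i : Fin N} {K : Subfield E} (hK : K ≤ stage ι z i) {α a : E}
    (hA : Affine σ K (z i) α a) (ht : α = 1 ∨ a = 0) : stepCoeff σ ι z i ∈ K := by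
  rw [stepCoeff]
  rcases ht with rfl | rfl
  · have : σ (z i) - z i = a := by rw [hA.map_eq]; ring
    rw [this, if_pos (hK hA.add_mem)]
    exact hA.add_mem
  · split_ifs with hmem
    · have e : σ (z i) - z i = (α - 1) * z i := by rw [hA.map_eq]; ring
      rw [e] at hmem ⊢
      by_cases h1 : α - 1 = 0
      · rw [h1, zero_mul]; exact zero_mem _
      · exfalso
        refine (h.transOver_stage i).notMem ?_
        have := div_mem hmem (sub_mem (hK hA.mul_mem) (one_mem _))
        rwa [mul_div_cancel_left₀ _ h1] at this
    · rw [hA.map_eq, add_zero, mul_div_cancel_right₀ _ (h.transOver_stage i).ne_zero]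
      exact hA.mul_mem

theorem exists_affine (i : Fin N) :
    ∃ α a, Affine σ (stage ι z i) (z i) α a ∧ (α = 1 ∨ a = 0) := by
  rcases h.steps i with h | h <;> obtain ⟨a, ha, h0, hs⟩ := h.shift
  · exact ⟨1, a, ⟨one_mem _, one_ne_zero, ha, by rw [hs]; ring⟩, Or.inl rfl⟩
  · exact ⟨a, 0, ⟨ha, h0, zero_mem _, by rw [hs]; ring⟩, Or.inr rfl⟩

theorem stepCoeff_mem_lower (i : Fin N) : stepCoeff σ ι z i ∈
    adj ι.fieldRange (z '' {l | l < i ∧ genDepth σ ι z l < genDepth σ ι z i}) := by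
  classical
  obtain ⟨α, a, hA, ht⟩ := h.exists_affine i
  have hmem := h.stepCoeff_mem le_rfl hA ht
  refine mem_adj_of_occurs (adj_image_mono (Set.subset_univ _) hmem) fun j hj => ?_
  have hji : j < i := h.occurs_mem hmem hj
  refine ⟨hji, ?_⟩
  rw [genDepth.eq_def σ ι z i, Nat.lt_succ_iff]
  exact Finset.le_sup (f := fun j : {j : Fin N // j < i} => genDepth σ ι z j.1)
    (b := ⟨j, hji⟩) (by simpa using hj)

theorem genDepth_le {i : Fin N} {k : ℕ}
    (hk : stepCoeff σ ι z i ∈ adj ι.fieldRange (z '' {l | l < i ∧ genDepth σ ι z l ≤ k})) :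
    genDepth σ ι z i ≤ k + 1 := by
  classical
  rw [genDepth.eq_def σ ι z i]
  refine Nat.succ_le_succ (Finset.sup_le fun j hj => ?_)
  exact (h.occurs_mem hk (by simpa using hj)).2

/-- Any grading compatible with the steps dominates the depth. So depths in the new tower need only
be bounded by the levels, not computed. -/
theorem genDepth_le_of_affine (D : Fin N → ℕ) (hD : ∀ i, 1 ≤ D i)
    (hA : ∀ i, ∃ α a, Affine σ (adj ι.fieldRange (z '' {l | l < i ∧ D l < D i})) (z i) α a ∧
      (α = 1 ∨ a = 0)) (i : Fin N) : genDepth σ ι z i ≤ D i := by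
  induction i using WellFoundedLT.induction with
  | _ i ih =>
    obtain ⟨α, a, hA, ht⟩ := hA i
    have hle : adj ι.fieldRange (z '' {l | l < i ∧ D l < D i}) ≤ stage ι z i :=
      adj_image_mono fun l hl => hl.1
    have hmem := h.stepCoeff_mem hle hA ht
    have hi := hD i
    have hle' : adj ι.fieldRange (z '' {l | l < i ∧ D l < D i}) ≤
        adj ι.fieldRange (z '' {l | l < i ∧ genDepth σ ι z l ≤ D i - 1}) := by
      refine adj_image_mono fun l hl => ⟨hl.1, ?_⟩
      have h1 := ih l hl.1
      have h2 := hl.2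
      omega
    have := h.genDepth_le (hle' hmem)
    omega

theorem gradedTower : GradedTower σ ι.fieldRange z (genDepth σ ι z) where
  stable := by
    refine .of_forall ?_ ?_
    · rintro _ ⟨g, rfl⟩
      exact ⟨σG g, (h.compat g).symm⟩
    · rintro _ ⟨g, rfl⟩
      refine ⟨σG.symm g, ?_⟩
      rw [eq_comm, RingEquiv.symm_apply_eq, h.compat, RingEquiv.apply_symm_apply]
  const _ hc := h.fixed_mem_range hc
  trans := h.transOver_adj
  step i := by
    obtain ⟨α, a, hA, ht⟩ := h.exists_affine i
    have hmem := h.stepCoeff_mem_lower i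
    have hle : adj ι.fieldRange (z '' {l | l < i ∧ genDepth σ ι z l < genDepth σ ι z i}) ≤
        stage ι z i := adj_image_mono fun l hl => hl.1
    have hdisj := (h.transOver_stage i)
    rw [stepCoeff] at hmem
    split_ifs at hmem with hs
    · exact ⟨1, _, ⟨one_mem _, one_ne_zero, hmem, by ring⟩, Or.inl rfl⟩
    · rcases ht with rfl | rfl
      · exact absurd (by rw [hA.map_eq, one_mul, add_sub_cancel_left]; exact hA.add_mem) hs
      · have e : σ (z i) / z i = α := by
          rw [hA.map_eq, add_zero, mul_div_cancel_right₀ _ hdisj.ne_zero]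
        rw [e] at hmem
        exact ⟨α, 0, ⟨hmem, hA.mul_ne, zero_mem _, hA.map_eq⟩, Or.inr rfl⟩
  pos i := by rw [genDepth]; omega

end IsPiSigmaExt

end Stage

/-! ### Transport of steps along embeddings of difference fields. -/

section Map

open Polynomial

variable {F E : Type*} [Field F] [Field E] {φ : F →+* E} {K : Subfield F} {σF : F ≃+* F}
  {σE : E ≃+* E} {s : F}

theorem transOver_map_iff : TransOver (K.map φ) (φ s) ↔ TransOver K s := by
  constructor
  · intro h p hp hs
    refine (Polynomial.map_eq_zero φ).1 (h (p.map φ) (mem_polyIn.2 fun n => ?_) ?_)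
    · rw [coeff_map]; exact ⟨_, mem_polyIn.1 hp n, rfl⟩
    · rw [eval_map, eval₂_hom, hs, map_zero]
  · intro h p hp hs
    have hr : p ∈ (mapRingHom φ).range := by
      rw [mem_map_range]
      intro n
      obtain ⟨a, -, ha⟩ := mem_polyIn.1 hp n
      exact ⟨a, ha⟩
    obtain ⟨p, rfl⟩ := hr
    rw [coe_mapRingHom] at hs hp ⊢
    rw [eval_map, eval₂_hom, map_eq_zero] at hs
    rw [h p (mem_polyIn.2 fun n => ?_) hs, Polynomial.map_zero]
    obtain ⟨a, ha, he⟩ := mem_polyIn.1 hp n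
    rw [coeff_map] at he
    rwa [← φ.injective he]

theorem Subfield.mem_map_iff {x : F} : φ x ∈ K.map φ ↔ x ∈ K :=
  ⟨fun ⟨_, hy, h⟩ => φ.injective h ▸ hy, fun h => ⟨x, h, rfl⟩⟩

theorem map_adj (S : Set F) : (adj K S).map φ = adj (K.map φ) (φ '' S) := by
  rw [adj, RingHom.map_field_closure, Set.image_union]; rfl

/-- One direction carries the steps of `F` into an extension; the other brings the steps found
inside `E` back to the subfield `L`. -/
theorem isSigmaStep_map_iff (h : ∀ a, σE (φ a) = φ (σF a)) :
    IsSigmaStep σE (K.map φ) (φ s) ↔ IsSigmaStep σF K s := by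
  have hcl : Subfield.closure ((K.map φ : Set E) ∪ {φ s}) =
      (Subfield.closure ((K : Set F) ∪ {s})).map φ := by
    rw [RingHom.map_field_closure, Set.image_union, Set.image_singleton]; rfl
  constructor
  · rintro ⟨h1, ⟨_, ⟨a, ha, rfl⟩, h0, hs⟩, h3⟩
    refine ⟨transOver_iff.1 (transOver_map_iff.1 (transOver_iff.2 h1)),
      ⟨a, ha, by simpa using h0, ?_⟩, fun c hc hσ => ?_⟩
    · rw [h, ← map_add] at hs
      exact φ.injective hs
    · rw [hcl] at h3
      exact Subfield.mem_map_iff.1 (h3 (φ c) ⟨c, hc, rfl⟩ (by rw [h, hσ]))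
  · rintro ⟨h1, ⟨a, ha, h0, hs⟩, h3⟩
    refine ⟨transOver_iff.1 (transOver_map_iff.2 (transOver_iff.2 h1)),
      ⟨φ a, ⟨a, ha, rfl⟩, by simpa using h0, by rw [h, hs, map_add]⟩, fun c hc hσ => ?_⟩
    rw [hcl] at hc
    obtain ⟨c, hc, rfl⟩ := hc
    exact ⟨c, h3 c hc (φ.injective (by rw [← h, hσ])), rfl⟩

theorem IsPiStep.map (h : ∀ a, σE (φ a) = φ (σF a)) (hs : IsPiStep σF K s) :
    IsPiStep σE (K.map φ) (φ s) := by
  have hcl : Subfield.closure ((K.map φ : Set E) ∪ {φ s}) =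
      (Subfield.closure ((K : Set F) ∪ {s})).map φ := by
    rw [RingHom.map_field_closure, Set.image_union, Set.image_singleton]; rfl
  obtain ⟨h1, ⟨a, ha, h0, hs⟩, h3⟩ := hs
  refine ⟨transOver_iff.1 (transOver_map_iff.2 (transOver_iff.2 h1)),
    ⟨φ a, ⟨a, ha, rfl⟩, by simpa using h0, by rw [h, hs, map_mul]⟩, fun c hc hσ => ?_⟩
  rw [hcl] at hc
  obtain ⟨c, hc, rfl⟩ := hc
  exact ⟨c, h3 c hc (φ.injective (by rw [← h, hσ])), rfl⟩

theorem Affine.comap (h : ∀ a, σE (φ a) = φ (σF a)) {α a : E}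
    (hA : Affine σE (K.map φ) (φ s) α a) (ht : α = 1 ∨ a = 0) :
    ∃ α' a', Affine σF K s α' a' ∧ (α' = 1 ∨ a' = 0) := by
  obtain ⟨⟨α, hα, rfl⟩, h0, ⟨a, ha, rfl⟩, he⟩ := hA
  refine ⟨α, a, ⟨hα, by simpa using h0, ha, φ.injective ?_⟩, ?_⟩
  · rw [← h, he, map_add, map_mul]
  · exact ht.imp (fun h => φ.injective (by rw [h, map_one])) fun h => φ.injective (by rw [h, map_zero])

/-- The restriction of `σ` to a stable subfield. -/
def Stable.restrict {σE : E ≃+* E} {L : Subfield E} (h : Stable σE L) : L ≃+* L where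
  toFun x := ⟨σE x, (h x).2 x.2⟩
  invFun x := ⟨σE.symm x, h.symm_mem x.2⟩
  left_inv x := Subtype.ext (σE.symm_apply_apply x)
  right_inv x := Subtype.ext (σE.apply_symm_apply x)
  map_mul' x y := Subtype.ext (map_mul σE (x : E) y)
  map_add' x y := Subtype.ext (map_add σE (x : E) y)

end Map

/-! ### Concatenated towers, and the replacement of a `ΠΣ*`-extension by a `Σ*`-extension. -/

section Append

variable {G F E : Type u} [Field G] [Field F] [Field E] {ι : G →+* F} {κ : F →+* E} {n r : ℕ}
  {t : Fin n → F} {x : Fin r → E} {σG : G ≃+* G} {σF : F ≃+* F} {σE : E ≃+* E}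

theorem map_stage (φ : F →+* E) (i : ℕ) :
    (stage ι t i).map φ = stage (φ.comp ι) (φ ∘ t) i := by
  rw [stage, stage, RingHom.map_field_closure, Set.image_union, ← Set.range_comp,
    ← Set.image_comp]
  rfl

theorem stage_append_of_le {i : ℕ} (hi : i ≤ n) :
    stage (κ.comp ι) (Fin.append (κ ∘ t) x) i = (stage ι t i).map κ := by
  rw [map_stage, stage, stage]
  congr 2
  ext v
  constructor
  · rintro ⟨l, hl, rfl⟩
    have hl' : (l : ℕ) < i := hl
    exact ⟨⟨l, by omega⟩, hl, (Fin.append_left (κ ∘ t) x ⟨l, by omega⟩).symm⟩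
  · rintro ⟨l, hl, rfl⟩
    exact ⟨Fin.castAdd r l, hl, Fin.append_left _ _ _⟩

theorem stage_append_add (htop : stage ι t n = ⊤) (j : ℕ) :
    stage (κ.comp ι) (Fin.append (κ ∘ t) x) (n + j) = stage κ x j := by
  apply le_antisymm
  · refine Subfield.closure_le.2 (Set.union_subset ?_ ?_)
    · rintro _ ⟨g, rfl⟩
      exact map_mem_stage κ x j (ι g)
    · rintro _ ⟨l, hl, rfl⟩
      have hl' : (l : ℕ) < n + j := hl
      induction l using Fin.addCases with
      | left l => rw [Fin.append_left]; exact map_mem_stage κ x j (t l)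
      | right l =>
        rw [Fin.append_right]
        exact gen_mem_stage κ x j l (by simpa using hl')
  · refine Subfield.closure_le.2 (Set.union_subset ?_ ?_)
    · rintro _ ⟨a, rfl⟩
      refine stage_mono _ _ (Nat.le_add_right n j) ?_
      rw [stage_append_of_le le_rfl, htop]
      exact ⟨a, Subfield.mem_top a, rfl⟩
    · rintro _ ⟨l, hl, rfl⟩
      have hl' : (l : ℕ) < j := hl
      have := gen_mem_stage (κ.comp ι) (Fin.append (κ ∘ t) x) (n + j) (Fin.natAdd n l)
        (by simpa using hl')
      rwa [Fin.append_right] at this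

theorem IsPiSigmaExt.append (hF : IsPiSigmaExt σG σF ι t) (hE : IsPiSigmaExt σF σE κ x) :
    IsPiSigmaExt σG σE (κ.comp ι) (Fin.append (κ ∘ t) x) where
  compat g := by rw [RingHom.comp_apply, hE.compat, hF.compat]; rfl
  generates := by rw [stage_append_add hF.generates, hE.generates]
  steps i := by
    induction i using Fin.addCases with
    | left i =>
      rw [Fin.append_left, Fin.val_castAdd, stage_append_of_le i.2.le]
      exact (hF.steps i).imp (isSigmaStep_map_iff hE.compat).2 (IsPiStep.map hE.compat)
    | right i =>
      rw [Fin.append_right, Fin.val_natAdd, stage_append_add hF.generates]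
      exact hE.steps i

theorem IsSigmaExt.isPiSigmaExt (h : IsSigmaExt σF σE κ x) : IsPiSigmaExt σF σE κ x :=
  ⟨h.compat, h.generates, fun i => Or.inl (h.steps i)⟩

/-- A telescoping equation over a `ΠΣ*`-extension `F` that has a solution in a `ΠΣ*`-extension
of `F` has one in a `Σ*`-extension of `F` of no larger extension depth. -/
theorem exists_isSigmaExt [CharZero G] (hF : IsPiSigmaExt σG σF ι t)
    (hE : IsPiSigmaExt σF σE κ x) {f : F} {g : E} (hg : σE g - g = κ f) :
    ∃ (L : Type u) (_ : Field L) (σL : L ≃+* L) (κL : F →+* L) (q : ℕ) (w : Fin q → L),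
      IsSigmaExt σF σL κL w ∧ extDepth ι t σL κL w ≤ extDepth ι t σE κ x ∧
        ∃ g : L, σL g - g = κL f := by
  have : CharZero E := charZero_of_injective_ringHom (κ.comp ι).injective
  have hall := hF.append hE
  set z := Fin.append (κ ∘ t) x with hzdef
  set B := (κ.comp ι).fieldRange with hB
  set D := genDepth σE (κ.comp ι) z with hD
  have hz : GradedTower σE B z D := hall.gradedTower
  have hbase : adj B (z '' {i : Fin (n + r) | (i : ℕ) < n}) = κ.fieldRange := by
    change stage (κ.comp ι) z n = _
    rw [stage_append_of_le le_rfl, hF.generates]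
    exact κ.fieldRange_eq_map.symm
  obtain ⟨y, e, q, hy, he, hsol⟩ := exists_isSigmaTower hz (Nat.le_add_right n r)
    (d := extDepth ι t σE κ x) (by
      intro i hi
      obtain ⟨j, rfl⟩ : ∃ j : Fin r, i = Fin.natAdd n j :=
        ⟨⟨i - n, by omega⟩, Fin.ext (by simp; omega)⟩
      exact Finset.le_sup (f := fun j : Fin r => D (Fin.natAdd n j)) (Finset.mem_univ j)) (by
      rw [← hall.generates, stage_eq_adj]
      congr 2
      ext l
      simp)
  have hLdef : ∀ j, adj B (z '' {i : Fin (n + r) | (i : ℕ) < n} ∪ y '' {l | l < j}) =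
      adj κ.fieldRange (y '' {l | l < j}) := fun j => by rw [← adj_adj, hbase]
  have hΔ : ∀ j < q, σE (y j) - y j ∈ adj κ.fieldRange (y '' {l | l < j}) := by
    intro j hj
    rw [← hLdef]
    exact adj_mono le_rfl (Set.union_subset_union (Set.image_mono fun l hl => hl.1)
      (Set.image_mono fun l hl => hl.1)) (hy j hj).2.1
  have hAff : ∀ j < q, Affine σE (adj κ.fieldRange (y '' {l | l < j})) (y j) 1
      (σE (y j) - y j) := fun j hj => ⟨one_mem _, one_ne_zero, hΔ j hj, by ring⟩
  have hst : ∀ j ≤ q, Stable σE (adj κ.fieldRange (y '' {l | l < j})) := by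
    intro j
    induction j with
    | zero =>
      intro _
      rw [← hbase, adj_adj, show {l : ℕ | l < 0} = ∅ by ext; simp, Set.image_empty,
        Set.union_empty]
      exact hz.stable_adj fun i hi l hl _ => lt_trans (Fin.lt_def.1 hl) hi
    | succ j ih =>
      intro hj
      have hset : {l : ℕ | l < j + 1} = insert j {l | l < j} := by
        ext l
        simp only [Set.mem_ofPred_eq, Set.mem_insert_iff]
        omega
      rw [hset, Set.image_insert_eq, ← Set.union_singleton, ← adj_adj]
      exact (ih (by omega)).adj_singleton (hAff j (by omega))
  have hC : ∀ j c, σE c = c → c ∈ adj κ.fieldRange (y '' {l | l < j}) := fun j c hc => by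
    obtain ⟨g, rfl⟩ := hall.fixed_mem_range hc
    exact le_adj _ ⟨ι g, rfl⟩
  -- As `y j` is not in the preceding field, it is transcendental over it, and its difference is
  -- nonzero, for otherwise it would be a constant. No constants are added, since all constants of
  -- `E` come from `G`.
  have hstep : ∀ j < q, IsSigmaStep σE (adj κ.fieldRange (y '' {l | l < j})) (y j) := by
    intro j hj
    have hyn : y j ∉ adj κ.fieldRange (y '' {l | l < j}) := by
      rw [← hLdef]; exact (hy j hj).2.2
    refine ⟨transOver_iff.1 (by_contra fun hn =>
      hyn (mem_of_not_transOver (hst j hj.le) (hC j) (hAff j hj) hn)),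
      ⟨_, hΔ j hj, fun h0 => hyn (hC j _ (sub_eq_zero.1 h0)), by ring⟩, fun c _ hc => hC j c hc⟩
  set L := adj κ.fieldRange (y '' {l | l < q}) with hL
  have hcompat : ∀ a : L, σE (L.subtype a) = L.subtype ((hst q le_rfl).restrict a) :=
    fun _ => rfl
  set κL : F →+* L := κ.codRestrict L fun a => le_adj _ ⟨a, rfl⟩ with hκL
  have hκ : L.subtype.comp κL = κ := rfl
  set w : Fin q → L := fun j => ⟨y j, mem_adj_of_mem ⟨j, j.2, rfl⟩⟩ with hw
  have hstage : ∀ i ≤ q, (stage κL w i).map L.subtype = adj κ.fieldRange (y '' {l | l < i}) := by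
    intro i hi
    rw [map_stage, hκ, stage_eq_adj]
    congr 1
    ext v
    constructor
    · rintro ⟨l, hl, rfl⟩
      exact ⟨l, hl, rfl⟩
    · rintro ⟨l, hl, rfl⟩
      exact ⟨⟨l, lt_of_lt_of_le hl hi⟩, hl, rfl⟩
  have hext : IsSigmaExt σF (hst q le_rfl).restrict κL w := by
    refine ⟨fun a => Subtype.ext (hE.compat a), ?_, fun i => ?_⟩
    · refine eq_top_iff.2 fun a _ => Subfield.mem_map_iff (φ := L.subtype).1 ?_
      rw [hstage q le_rfl]
      exact a.2
    · rw [← isSigmaStep_map_iff hcompat, hstage i i.2.le]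
      exact hstep i i.2
  refine ⟨L, inferInstance, (hst q le_rfl).restrict, κL, q, w, hext, ?_, ?_⟩
  -- The grading to compare with: the depth in the old tower for generators of `F`, the level for
  -- the `y j`.
  · set D' : Fin (n + q) → ℕ := Fin.append (fun i : Fin n => D (Fin.castAdd r i))
      (fun j : Fin q => e j) with hD'
    have hB' : ∀ S : Set (Fin (n + q)),
        (adj (κL.comp ι).fieldRange (Fin.append (κL ∘ t) w '' S)).map L.subtype =
        adj B ((fun l => L.subtype (Fin.append (κL ∘ t) w l)) '' S) := by
      intro S
      rw [map_adj, ← Set.image_comp, RingHom.map_fieldRange]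
      rfl
    refine Finset.sup_le fun j _ => ?_
    have hbound := (hF.append hext.isPiSigmaExt).genDepth_le_of_affine D' (fun i => ?_)
      (fun i => ?_) (Fin.natAdd n j)
    · refine hbound.trans ?_
      rw [hD', Fin.append_right]
      exact he j j.2
    · induction i using Fin.addCases with
      | left i => rw [hD', Fin.append_left]; exact hz.pos _
      | right i => rw [hD', Fin.append_right]; exact (hy i i.2).1
    · have hleft : ∀ (k : Fin (n + q)) (l : Fin (n + r)) (hl : (l : ℕ) < n), (l : ℕ) < k →
          D l < D' k → z l ∈ adj B ((fun l => L.subtype (Fin.append (κL ∘ t) w l)) ''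
            {l | l < k ∧ D' l < D' k}) := by
        intro k l hl hlk hDl
        obtain ⟨l, rfl⟩ : ∃ l' : Fin n, l = Fin.castAdd r l' := ⟨⟨l, hl⟩, rfl⟩
        refine mem_adj_of_mem ⟨Fin.castAdd q l, ⟨hlk, ?_⟩, ?_⟩
        · rwa [hD', Fin.append_left, ← hD']
        · simp only [Fin.append_left, hzdef]
          rfl
      induction i using Fin.addCases with
      | left i =>
        obtain ⟨α, a, hA, ht⟩ := hz.step (Fin.castAdd r i)
        refine Affine.comap hcompat (α := α) (a := a) ?_ ht
        rw [hB', Fin.append_left]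
        rw [hzdef, Fin.append_left, ← hzdef] at hA
        refine hA.mono (adj_image_le (le_adj _) fun l hl => ?_)
        have h1 : (l : ℕ) < i := Fin.lt_def.1 hl.1
        refine hleft _ l (h1.trans i.2) h1 ?_
        rw [hD', Fin.append_left]
        exact hl.2
      | right j =>
        refine Affine.comap hcompat (α := 1) (a := σE (y j) - y j) ?_ (Or.inl rfl)
        rw [hB', Fin.append_right]
        refine ⟨one_mem _, one_ne_zero, ?_, ?_⟩
        rotate_left
        · change σE (y j) = 1 * y j + (σE (y j) - y j)
          ring
        refine adj_le (le_adj _) (Set.union_subset ?_ ?_) (hy j j.2).2.1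
        · rintro _ ⟨l, ⟨hl, hDl⟩, rfl⟩
          refine hleft _ l hl ?_ ?_
          · rw [Fin.val_natAdd]; exact Nat.lt_add_right _ hl
          · rw [hD', Fin.append_right]; exact hDl
        · rintro _ ⟨l, ⟨hl, hel⟩, rfl⟩
          have hlq := hl.trans j.2
          refine mem_adj_of_mem ⟨Fin.natAdd n ⟨l, hlq⟩, ⟨?_, ?_⟩, ?_⟩
          · rw [Fin.lt_def, Fin.val_natAdd, Fin.val_natAdd]; exact Nat.add_lt_add_left hl n
          · rw [hD', Fin.append_right, Fin.append_right]; exact hel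
          · simp only [Fin.append_right]
            rfl
  · have hgL : g ∈ L := by
      rw [hL, ← hLdef]
      refine hsol g ?_
      rw [hg, hbase]
      exact ⟨f, rfl⟩
    exact ⟨⟨g, hgL⟩, Subtype.ext hg⟩

end Append

theorem mainTheorem9 {G F S : Type u} [Field G] [CharZero G] [Field F] [Field S]
    (σG : G ≃+* G) (σF : F ≃+* F) (σS : S ≃+* S)
    (ι : G →+* F) {n : ℕ} (t : Fin n → F) (hF : IsPiSigmaDeltaExt σG σF ι t)
    (κ : F →+* S) (s : S) (f : F)
    (hS : IsSigmaExt σF σS κ ![s]) (hs : σS s = s + κ f) :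
    IsSigmaDeltaStep ι t σF σS κ s f ↔
      ¬ ∃ (E : Type u) (_ : Field E) (σE : E ≃+* E) (κE : F →+* E) (r : ℕ) (x : Fin r → E),
        IsPiSigmaExt σF σE κE x ∧ extDepth ι t σE κE x ≤ depth σF ι t f ∧
          ∃ g : E, σE g - g = κE f := by
  constructor
  · rintro ⟨-, -, hopt⟩ ⟨E, _, σE, κE, r, x, hx, hd, g, hg⟩
    obtain ⟨L, _, σL, κL, q, w, hw, hwd, hsol⟩ := exists_isSigmaExt hF.isPiSigmaExt hx hg
    exact hopt ⟨L, _, σL, κL, q, w, hw, hwd.trans hd, hsol⟩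
  · intro h
    refine ⟨hS.compat, hs, ?_⟩
    rintro ⟨E, _, σE, κE, r, x, hx, hd, hg⟩
    exact h ⟨E, _, σE, κE, r, x, hx.isPiSigmaExt, hd, hg⟩
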